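/- **Setting.** Let $\mathcal F f(\xi)=\hat f(\xi)=\int_{\mathbb R^d} f(x)e^{-2\pi i x\cdot\xi}\,dx$, and let $\emptyset\ne\mathcal O\subset\mathbb R^d$ be open. Let $Z(\mathcal O)=\mathcal F(C_c^\infty(\mathcal O))$ carry the topology transported from $C_c^\infty(\mathcal O)$ by $\mathcal F$, let $Z'(\mathcal O)$ be its dual with the weak-$*$ topology, and for $f\in Z'(\mathcal O)$ put $\hat f=f\circ\mathcal F\in\mathcal D'(\mathcal O)$. Tempered distributions are regarded as elements of $Z'(\mathcal O)$ by restriction. Let $\mathcal Q=(Q_i)_{i\in I}$ be an admissible cover of $\mathcal O$: the $Q_i$ are nonempty, $\bigcup_i Q_i=\mathcal O$, and $\sup_i|i^*|<\infty$, where $i^*=\{\ell: Q_\ell\cap Q_i\neq\emptyset\}$. A BAPU for $\mathcal Q$ is a family $\Phi=(\varphi_i)_{i\in I}$ in $C_c^\infty(\mathcal O)$ with $\sum_i\varphi_i=1$ on $\mathcal O$, $\varphi_i=0$ on $\mathcal O\setminus Q_i$, and $\sup_i\|\mathcal F^{-1}\varphi_i\|_{L^1}<\infty$; fix such a $\Phi$.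 Let $w=(w_i)_{i\in I}$ be positive and $\mathcal Q$-moderate, i.e. $\sup_i\sup_{\ell\in i^*}w_i/w_\ell<\infty$. For $p,q\in[1,\infty]$ and $f\in Z'(\mathcal O)$ let $$\|f\|_{\mathcal D(\mathcal Q,L^p,\ell^q_w)}=\Big\|\big(w_i\,\|\mathcal F^{-1}(\varphi_i\hat f)\|_{L^p}\big)_{i\in I}\Big\|_{\ell^q},$$ and let $\mathcal D(\mathcal Q,L^p,\ell^q_w)$ be the space of $f\in Z'(\mathcal O)$ for which this is finite. Let $\|\Gamma_{\mathcal Q}\|$ be the operator norm on $\ell^q_w(I)=\{c:(w_ic_i)_i\in\ell^q\}$ of $\Gamma_{\mathcal Q}:(c_i)_i\mapsto(\sum_{\ell\in i^*}c_\ell)_i$. Let $J$ be countable, $C_j\in GL(d,\mathbb R)$, and $g_j\in L^1(\mathbb R^d)\cap L^2(\mathbb R^d)$ with $\hat g_j\in C^\infty$ $(j\in J)$, and assume that there are $A,B>0$ with $A\le\sum_j|\det C_j|^{-1}|\hat g_j(\xi)|^2\le B$ for a.e. $\xi$. Write $T_yg=g(\cdot-y)$. Let $v=(v_j)_{j\in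 J}$ be a positive weight, put $$\|c\|_{Y_v^{p,q}}=\Big\|\big(v_j|\det C_j|^{\frac1p-\frac12}\|(c^{(j)}_k)_{k\in\mathbb Z^d}\|_{\ell^p}\big)_{j\in J}\Big\|_{\ell^q},$$ and let $Y_v^{p,q}$ be the space of $c\in\mathbb C^{J\times\mathbb Z^d}$ for which this is finite. Assume that the system $(T_{C_jk}g_j)_{j\in J,k\in\mathbb Z^d}$ is $(w,v,\Phi)$-adapted: the matrix $$M_{i,j}=\max\Big\{\frac{w_i}{v_j},\frac{v_j}{w_i}\Big\}\,|\det C_j|^{1/2}\sum_{n\in\mathbb Z^d}\big\|\mathbf 1_{n+[0,1]^d}\cdot\big((\mathcal F^{-1}\varphi_i*g_j)\circ C_j\big)\big\|_{L^\infty}$$ satisfies $\|M\|_{\mathrm{Schur}}:=\max\{\sup_i\sum_jM_{i,j},\ \sup_j\sum_iM_{i,j}\}<\infty$. For $f\in Z'(\mathcal O)$ and $g\in L^1$ with $\hat g\in C^\infty$, the extended pairing with respect to a BAPU $\Psi=(\psi_i)_i$ is $\langle f\mid g\rangle_\Psi=\sum_{i}\hat f(\overline{\psi_i\hat g})$; it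 is called well-defined if the series converges absolutely. **Proposition and corollary.** Let $p,q\in[1,\infty]$. Then $\|\Gamma_{\mathcal Q}\|<\infty$ and the following hold. 1. The synthesis operator $\mathscr D:Y_v^{p,q}\to\mathcal D(\mathcal Q,L^p,\ell^q_w)$, $c\mapsto\sum_{j\in J}\sum_{k\in\mathbb Z^d}c^{(j)}_k\,T_{C_jk}g_j$, is well-defined, linear and bounded, with $\|\mathscr D\|\le\|M\|_{\mathrm{Schur}}$, and the double series converges unconditionally in $Z'(\mathcal O)$. 2. The coefficient operator $\mathscr C:\mathcal D(\mathcal Q,L^p,\ell^q_w)\to Y_v^{p,q}$, $f\mapsto(\langle f\mid T_{C_jk}g_j\rangle_\Phi)_{j,k}$, is well-defined, linear and bounded, with $\|\mathscr C\|\le\|M\|_{\mathrm{Schur}}\,\|\Gamma_{\mathcal Q}\|$. 3. If $\Psi$ is another BAPU for $\mathcal Q$ and $f\in\mathcal D(\mathcal Q,L^p,\ell^q_w)$, then $\langle f\mid T_{C_jk}g_j\rangle_\Psi$ is well-defined and equals $\langle f\mid T_{C_jk}g_j\rangle_\Phi$, for all $j\in J$, $k\in\mathbb Z^d$. 4. The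 frame operator $S=\mathscr D\circ\mathscr C$ is well-defined and bounded on $\mathcal D(\mathcal Q,L^p,\ell^q_w)$. 5. Let $f_n\in\mathcal D(\mathcal Q,L^p,\ell^q_w)$ $(n\in\mathbb N)$ with $f_n\to f$ in $Z'(\mathcal O)$, and suppose that there are functions $F_i:\mathbb R^d\to[0,\infty)$ in $L^p$ with $\|(w_i\|F_i\|_{L^p})_i\|_{\ell^q}<\infty$ and $|\mathcal F^{-1}(\varphi_i\hat f_n)|\le F_i$ for all $i\in I$, $n\in\mathbb N$. Then $f\in\mathcal D(\mathcal Q,L^p,\ell^q_w)$ and $Sf_n\to Sf$ in $Z'(\mathcal O)$. -/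

import Mathlib

open MeasureTheory TopologicalSpace FourierTransform Filter
open scoped ENNReal NNReal ContDiff Topology Distributions SchwartzMap PointwiseConvergenceCLM

namespace GSIFrame

noncomputable section

/-- Euclidean space `ℝ^d` (also used for the Fourier domain). -/
abbrev RR (d : ℕ) := EuclideanSpace ℝ (Fin d)

/-! ### Weighted sequence norms with values in `[0, ∞]` -/

section Sequences

/-- The `ℓ^q` norm of a family of elements of `[0, ∞]`, for `q ∈ [1, ∞]`. -/
def lqNorm {ι : Type*} (q : ℝ≥0∞) (a : ι → ℝ≥0∞) : ℝ≥0∞ :=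
  if q = ⊤ then ⨆ i, a i else (∑' i, a i ^ q.toReal) ^ (q.toReal)⁻¹

theorem one_le_toReal {q : ℝ≥0∞} (h1 : 1 ≤ q) (hq : q ≠ ⊤) : 1 ≤ q.toReal := by
  have := (ENNReal.toReal_le_toReal ENNReal.one_ne_top hq).2 h1
  simpa using this

theorem lqNorm_mono {ι : Type*} (q : ℝ≥0∞) {a b : ι → ℝ≥0∞} (h : ∀ i, a i ≤ b i) :
    lqNorm q a ≤ lqNorm q b := by
  unfold lqNorm
  split_ifs with hq
  · exact iSup_mono h
  · exact ENNReal.rpow_le_rpow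
      (ENNReal.tsum_le_tsum fun i => ENNReal.rpow_le_rpow (h i) ENNReal.toReal_nonneg)
      (inv_nonneg.2 ENNReal.toReal_nonneg)

theorem lqNorm_add_le {ι : Type*} (q : ℝ≥0∞) (h1 : 1 ≤ q) (a b : ι → ℝ≥0∞) :
    lqNorm q (fun i => a i + b i) ≤ lqNorm q a + lqNorm q b := by
  unfold lqNorm
  split_ifs with hq
  · exact iSup_le fun i => add_le_add (le_iSup a i) (le_iSup b i)
  · have hr := one_le_toReal h1 hq
    have hr0 : 0 < q.toReal := by linarith
    rw [ENNReal.rpow_inv_le_iff hr0, ENNReal.tsum_eq_iSup_sum]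
    refine iSup_le fun s => ?_
    rw [← ENNReal.rpow_inv_le_iff hr0]
    have := ENNReal.Lp_add_le s a b hr
    simp only [one_div] at this
    refine this.trans (add_le_add ?_ ?_) <;>
      exact ENNReal.rpow_le_rpow (ENNReal.sum_le_tsum s) (inv_nonneg.2 hr0.le)

theorem lqNorm_const_mul {ι : Type*} (q : ℝ≥0∞) (h1 : 1 ≤ q) (r : ℝ≥0∞) (a : ι → ℝ≥0∞) :
    lqNorm q (fun i => r * a i) = r * lqNorm q a := by
  unfold lqNorm
  split_ifs with hq
  · rw [ENNReal.mul_iSup]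
  · have hr0 : 0 < q.toReal := by linarith [one_le_toReal h1 hq]
    simp_rw [ENNReal.mul_rpow_of_nonneg _ _ hr0.le]
    rw [ENNReal.tsum_mul_left, ENNReal.mul_rpow_of_nonneg _ _ (inv_nonneg.2 hr0.le),
      ENNReal.rpow_rpow_inv hr0.ne']

theorem lqNorm_zero {ι : Type*} (q : ℝ≥0∞) (h1 : 1 ≤ q) :
    lqNorm q (fun _ : ι => 0) = 0 := by
  simpa using lqNorm_const_mul q h1 0 (fun _ : ι => 0)

/-- The weighted norm `‖a‖_{ℓ^q_w} = ‖(w_i a_i)_i‖_{ℓ^q}` of a family in `[0, ∞]`. -/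
def wlqNorm {ι : Type*} (q : ℝ≥0∞) (w : ι → ℝ) (a : ι → ℝ≥0∞) : ℝ≥0∞ :=
  lqNorm q fun i => ENNReal.ofReal (w i) * a i

theorem wlqNorm_mono {ι : Type*} (q : ℝ≥0∞) (w : ι → ℝ) {a b : ι → ℝ≥0∞} (h : ∀ i, a i ≤ b i) :
    wlqNorm q w a ≤ wlqNorm q w b :=
  lqNorm_mono q fun i => mul_le_mul_right (h i) _

theorem wlqNorm_add_le {ι : Type*} (q : ℝ≥0∞) (h1 : 1 ≤ q) (w : ι → ℝ) (a b : ι → ℝ≥0∞) :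
    wlqNorm q w (fun i => a i + b i) ≤ wlqNorm q w a + wlqNorm q w b := by
  unfold wlqNorm
  simp_rw [mul_add]
  exact lqNorm_add_le q h1 _ _

theorem wlqNorm_const_mul {ι : Type*} (q : ℝ≥0∞) (h1 : 1 ≤ q) (w : ι → ℝ) (r : ℝ≥0∞)
    (a : ι → ℝ≥0∞) : wlqNorm q w (fun i => r * a i) = r * wlqNorm q w a := by
  unfold wlqNorm
  rw [← lqNorm_const_mul q h1]
  simp_rw [mul_left_comm]

theorem wlqNorm_zero {ι : Type*} (q : ℝ≥0∞) (h1 : 1 ≤ q) (w : ι → ℝ) :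
    wlqNorm q w (fun _ : ι => 0) = 0 := by
  simpa using wlqNorm_const_mul q h1 w 0 (fun _ : ι => 0)

/-- The Schur norm of a matrix with entries in `[0, ∞]`. -/
def schurNorm {I J : Type*} (M : I → J → ℝ≥0∞) : ℝ≥0∞ :=
  max (⨆ i, ∑' j, M i j) (⨆ j, ∑' i, M i j)

end Sequences

/-! ### Covers, moderate weights, the clustering map -/

section Covers

variable {d : ℕ} {I : Type*}

/-- The cluster `i^* = {ℓ : Q_ℓ ∩ Q_i ≠ ∅}`. -/
def cluster (Q : I → Set (RR d)) (i : I) : Set I := {l | (Q l ∩ Q i).Nonempty}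

/-- `Q` is an admissible cover of the open set `O`. -/
structure IsAdmissibleCover (O : Opens (RR d)) (Q : I → Set (RR d)) : Prop where
  iUnion_eq : ⋃ i, Q i = (O : Set (RR d))
  nonempty : ∀ i, (Q i).Nonempty
  card_cluster_le : ∃ N : ℕ, ∀ i, (cluster Q i).encard ≤ N

/-- `w` is a `Q`-moderate weight. -/
structure IsModerateWeight (Q : I → Set (RR d)) (w : I → ℝ) : Prop where
  pos : ∀ i, 0 < w i
  moderate : ∃ K : ℝ, ∀ i, ∀ l ∈ cluster Q i, w i / w l ≤ K

/-- The clustering map `Γ_Q`, `(Γ_Q c)_i = ∑_{ℓ ∈ i^*} c_ℓ`; the sum is finite for an admissible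
cover. -/
def clusterMap (Q : I → Set (RR d)) (c : I → ℂ) (i : I) : ℂ := ∑ᶠ l ∈ cluster Q i, c l

/-- The operator norm of `Γ_Q` on `ℓ^q_w`. -/
def clusterNorm (Q : I → Set (RR d)) (w : I → ℝ) (q : ℝ≥0∞) : ℝ≥0∞ :=
  ⨆ (c : I → ℂ) (_ : wlqNorm q w (fun i => ‖c i‖ₑ) ≤ 1),
    wlqNorm q w (fun i => ‖clusterMap Q c i‖ₑ)

/-- `φ` is a bounded admissible partition of unity subordinate to the cover `Q` of `O`. -/
structure IsBAPU {O : Opens (RR d)} (Q : I → Set (RR d)) (φ : I → 𝓓(O, ℂ)) : Prop where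
  hasSum_one : ∀ ξ ∈ O, HasSum (fun i => φ i ξ) 1
  eq_zero : ∀ i, ∀ ξ ∈ O, ξ ∉ Q i → φ i ξ = 0
  bounded : ∃ K : ℝ≥0, ∀ i, eLpNorm (𝓕⁻ (φ i : RR d → ℂ)) 1 volume ≤ K

end Covers

/-! ### Test functions and Fourier distributions -/

section Distributions

variable {d : ℕ} {O : Opens (RR d)}

/-- The inclusion `C_c^∞(O) → 𝓢(ℝ^d)`. -/
def toSchwartz : 𝓓(O, ℂ) →L[ℂ] 𝓢(RR d, ℂ) :=
  TestFunction.mkCLM ℂ (fun φ => φ.hasCompactSupport.toSchwartzMap φ.contDiff)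
    (fun _ _ => rfl) (fun _ _ => rfl) (by
      intro K hK
      let T : 𝓓_{K}(RR d, ℂ) →ₗ[ℂ] 𝓢(RR d, ℂ) :=
        { toFun := fun f => f.hasCompactSupport.toSchwartzMap f.contDiff
          map_add' := fun _ _ => rfl
          map_smul' := fun _ _ => rfl }
      change Continuous T
      refine WithSeminorms.continuous_of_isBounded
        (ContDiffMapSupportedIn.withSeminorms ℂ (RR d) ℂ ⊤ K)
        (schwartz_withSeminorms ℂ (RR d) ℂ) T ?_
      refine Seminorm.IsBounded.of_real ?_
      rintro ⟨k, n⟩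
      obtain ⟨R, hR⟩ := K.isCompact.isBounded.exists_norm_le
      refine ⟨{n}, max R 0 ^ k, fun f => ?_⟩
      refine SchwartzMap.seminorm_le_bound ℂ k n _
        (mul_nonneg (pow_nonneg (le_max_right _ _) _) (apply_nonneg _ _)) fun x => ?_
      by_cases hx : x ∈ K
      · rw [Finset.sup_singleton]
        exact mul_le_mul
          (pow_le_pow_left₀ (norm_nonneg _) ((hR x hx).trans (le_max_left _ _)) k)
          (ContDiffMapSupportedIn.norm_iteratedFDeriv_apply_le_seminorm_top ℂ)
          (norm_nonneg _) (pow_nonneg (le_max_right _ _) _)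
      · have h0 : iteratedFDeriv ℝ n f x = 0 :=
          ContDiffMapSupportedIn.iteratedFDeriv_zero_on_compl f hx
        change ‖x‖ ^ k * ‖iteratedFDeriv ℝ n f x‖ ≤ _
        rw [h0, norm_zero, mul_zero]
        exact mul_nonneg (pow_nonneg (le_max_right _ _) _) (apply_nonneg _ _))

/-- Multiplication `g ↦ φ g` by a test function `φ ∈ C_c^∞(O)`, from `𝓢(ℝ^d)` to `C_c^∞(O)`. -/
def mulTest (φ : 𝓓(O, ℂ)) : 𝓢(RR d, ℂ) →L[ℂ] 𝓓(O, ℂ) where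
  toFun g :=
    { toFun := fun ξ => φ ξ * g ξ
      contDiff' := φ.contDiff.mul (g.smooth ⊤)
      hasCompactSupport' := φ.hasCompactSupport.mul_right
      tsupport_subset' := (tsupport_mul_subset_left (f := φ) (g := g)).trans φ.tsupport_subset }
  map_add' f g := by ext ξ; exact mul_add _ _ _
  map_smul' c g := by ext ξ; exact mul_left_comm _ _ _
  cont := by
    let K : Compacts (RR d) := ⟨tsupport φ, φ.hasCompactSupport⟩
    have hφ : Function.HasTemperateGrowth (φ : RR d → ℂ) :=
      φ.hasCompactSupport.hasTemperateGrowth φ.contDiff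
    let T : 𝓢(RR d, ℂ) →ₗ[ℂ] 𝓓_{K}(RR d, ℂ) :=
      { toFun := fun g => ContDiffMapSupportedIn.of_support_subset (f := fun ξ => φ ξ * g ξ)
          (φ.contDiff.mul (g.smooth ⊤))
          ((Function.support_mul_subset_left _ _).trans subset_closure)
        map_add' := fun f g => by ext ξ; exact mul_add _ _ _
        map_smul' := fun c g => by ext ξ; exact mul_left_comm _ _ _ }
    have hT : Continuous T := by
      refine WithSeminorms.continuous_of_continuous_comp
        (ContDiffMapSupportedIn.withSeminorms ℂ (RR d) ℂ ⊤ K) T fun i => ?_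
      refine Seminorm.continuous_of_le (q := (SchwartzMap.seminorm ℂ 0 i).comp
        (SchwartzMap.smulLeftCLM ℂ (φ : RR d → ℂ)).toLinearMap) ?_ ?_
      · exact ((schwartz_withSeminorms ℂ (RR d) ℂ).continuous_seminorm (0, i)).comp
          (SchwartzMap.smulLeftCLM ℂ (φ : RR d → ℂ)).continuous
      · intro g
        refine (ContDiffMapSupportedIn.seminorm_top_le_iff ℂ (apply_nonneg _ _) i _).2
          fun x _ => ?_
        have := SchwartzMap.norm_iteratedFDeriv_le_seminorm ℂ
          (SchwartzMap.smulLeftCLM ℂ (φ : RR d → ℂ) g) i x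
        rwa [SchwartzMap.smulLeftCLM_apply hφ] at this
    exact (TestFunction.continuous_ofSupportedIn φ.tsupport_subset).comp hT

/-- The product `φ G` of a test function `φ ∈ C_c^∞(O)` with a smooth function `G`. -/
def mulSmooth (φ : 𝓓(O, ℂ)) (G : RR d → ℂ) (hG : ContDiff ℝ ∞ G) : 𝓓(O, ℂ) where
  toFun := fun ξ => φ ξ * G ξ
  contDiff' := φ.contDiff.mul hG
  hasCompactSupport' := φ.hasCompactSupport.mul_right
  tsupport_subset' := (tsupport_mul_subset_left (f := φ) (g := G)).trans φ.tsupport_subset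

/-- The complex conjugate of a test function. -/
def conjTest (φ : 𝓓(O, ℂ)) : 𝓓(O, ℂ) := TestFunction.postcompCLM (Complex.conjCLE : ℂ →L[ℝ] ℂ) φ

variable (O) in
/-- The Fourier transform `C_c^∞(O) → 𝓢(ℝ^d)`, whose range is `Z(O)`. -/
def fourierTest : 𝓓(O, ℂ) →L[ℂ] 𝓢(RR d, ℂ) := (fourierCLM ℂ 𝓢(RR d, ℂ)) ∘L toSchwartz

variable (O) in
/-- The Fourier test function space `Z(O) = 𝓕(C_c^∞(O))`, as a vector space. -/
def FourierTest : Type := LinearMap.range (fourierTest O).toLinearMap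

instance : AddCommGroup (FourierTest O) :=
  inferInstanceAs (AddCommGroup (LinearMap.range (fourierTest O).toLinearMap))

instance : Module ℂ (FourierTest O) :=
  inferInstanceAs (Module ℂ (LinearMap.range (fourierTest O).toLinearMap))

/-- The topology of `Z(O)` is transported from `C_c^∞(O)` along the (bijective) Fourier
transform. -/
instance : TopologicalSpace (FourierTest O) :=
  TopologicalSpace.coinduced (fourierTest O).toLinearMap.rangeRestrict inferInstance

variable (O) in
/-- The Fourier transform `C_c^∞(O) → Z(O)`. -/
def fourierZ : 𝓓(O, ℂ) →L[ℂ] FourierTest O where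
  toLinearMap := (fourierTest O).toLinearMap.rangeRestrict
  cont := continuous_coinduced_rng

variable (O) in
/-- The inclusion `Z(O) → 𝓢(ℝ^d)`. -/
def inclZ : FourierTest O →L[ℂ] 𝓢(RR d, ℂ) where
  toLinearMap := (LinearMap.range (fourierTest O).toLinearMap).subtype
  cont := continuous_coinduced_dom.2 (fourierTest O).continuous

variable (O) in
/-- The space `Z'(O)` of Fourier distributions, the dual of `Z(O)`, with the topology of pointwise
convergence (the weak-star topology). -/
abbrev FourierDist := FourierTest O →Lₚₜ[ℂ] ℂ

/-- The Fourier transform `f ↦ f ∘ 𝓕` from `Z'(O)` to `𝓓'(O)`. -/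
def FourierDist.hat : FourierDist O →L[ℂ] (𝓓(O, ℂ) →Lₚₜ[ℂ] ℂ) :=
  PointwiseConvergenceCLM.precomp ℂ (fourierZ O)

variable (O) in
/-- The restriction map `𝓢'(ℝ^d) → Z'(O)`. -/
def restrictZ : 𝓢'(RR d, ℂ) →L[ℂ] FourierDist O := PointwiseConvergenceCLM.precomp ℂ (inclZ O)

/-- The map `u ↦ φ u` from `𝓓'(O)` to `𝓢'(ℝ^d)`, `(φ u) g = u (φ g)`, for `φ ∈ C_c^∞(O)`. -/
def mulDist (φ : 𝓓(O, ℂ)) : (𝓓(O, ℂ) →Lₚₜ[ℂ] ℂ) →L[ℂ] 𝓢'(RR d, ℂ) :=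
  PointwiseConvergenceCLM.precomp ℂ (mulTest φ)

/-- The frequency localization `f ↦ 𝓕⁻¹ (φ f^)` from `Z'(O)` to the tempered distributions. -/
def localize (φ : 𝓓(O, ℂ)) : FourierDist O →L[ℂ] 𝓢'(RR d, ℂ) :=
  (fourierInvCLM ℂ 𝓢'(RR d, ℂ)) ∘L (mulDist φ) ∘L FourierDist.hat

/-- The `L^p` norm of a tempered distribution, which is infinite if the distribution is not given
by an `L^p` function. -/
def temperedLpNorm (p : ℝ≥0∞) [Fact (1 ≤ p)] (T : 𝓢'(RR d, ℂ)) : ℝ≥0∞ :=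
  ⨅ (h : Lp ℂ p (volume : Measure (RR d))) (_ : Lp.toTemperedDistribution h = T), ‖h‖ₑ

theorem temperedLpNorm_add_le (p : ℝ≥0∞) [Fact (1 ≤ p)] (S T : 𝓢'(RR d, ℂ)) :
    temperedLpNorm p (S + T) ≤ temperedLpNorm p S + temperedLpNorm p T := by
  unfold temperedLpNorm
  simp_rw [ENNReal.iInf_add, ENNReal.add_iInf]
  refine le_iInf fun h => le_iInf fun hh => le_iInf fun k => le_iInf fun hk => ?_
  refine (iInf₂_le (h + k) ?_).trans (enorm_add_le h k)
  subst hh hk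
  exact map_add (Lp.toTemperedDistributionCLM ℂ volume p) h k

theorem temperedLpNorm_zero (p : ℝ≥0∞) [Fact (1 ≤ p)] :
    temperedLpNorm p (0 : 𝓢'(RR d, ℂ)) = 0 := by
  refine le_antisymm ((iInf₂_le (0 : Lp ℂ p (volume : Measure (RR d))) ?_).trans ?_) zero_le
  · exact map_zero (Lp.toTemperedDistributionCLM ℂ volume p)
  · simp

theorem temperedLpNorm_smul_le (p : ℝ≥0∞) [Fact (1 ≤ p)] (c : ℂ) (T : 𝓢'(RR d, ℂ)) :
    temperedLpNorm p (c • T) ≤ ‖c‖ₑ * temperedLpNorm p T := by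
  rcases eq_or_ne c 0 with rfl | hc
  · have h0 : (0 : ℂ) • T = 0 := by
      ext g
      exact zero_mul (T g)
    rw [h0, temperedLpNorm_zero]
    exact zero_le
  · unfold temperedLpNorm
    have h0 : ‖c‖ₑ ≠ 0 := enorm_ne_zero.2 hc
    rw [ENNReal.mul_iInf_of_ne h0 enorm_ne_top]
    refine le_iInf fun h => ?_
    rw [ENNReal.mul_iInf_of_ne h0 enorm_ne_top]
    refine le_iInf fun hh => ?_
    refine (iInf₂_le (c • h) ?_).trans (enorm_smul c h).le
    subst hh
    exact map_smul (Lp.toTemperedDistributionCLM ℂ volume p) c h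

end Distributions

/-! ### Besov-type decomposition spaces -/

section DecompositionSpaces

variable {d : ℕ} {I : Type*} {O : Opens (RR d)}

/-- The norm of the decomposition space `𝓓(Q, L^p, ℓ^q_w)`, computed with the BAPU `φ`. -/
def decompNorm (φ : I → 𝓓(O, ℂ)) (w : I → ℝ) (p q : ℝ≥0∞) [Fact (1 ≤ p)] (f : FourierDist O) :
    ℝ≥0∞ :=
  wlqNorm q w fun i => temperedLpNorm p (localize (φ i) f)

/-- The decomposition space `𝓓(Q, L^p, ℓ^q_w)`, as a subspace of `Z'(O)`. -/
def DecompSpace (φ : I → 𝓓(O, ℂ)) (w : I → ℝ) (p q : ℝ≥0∞) [Fact (1 ≤ p)] [hq : Fact (1 ≤ q)] :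
    Submodule ℂ (FourierDist O) where
  carrier := {f | decompNorm φ w p q f < ⊤}
  zero_mem' := by
    change decompNorm φ w p q 0 < ⊤
    unfold decompNorm
    simp_rw [map_zero, temperedLpNorm_zero]
    rw [wlqNorm_zero q hq.out]
    exact ENNReal.zero_lt_top
  add_mem' := by
    intro f g hf hg
    refine lt_of_le_of_lt ?_ (ENNReal.add_lt_top.2 ⟨hf, hg⟩)
    refine (wlqNorm_mono q w fun i => ?_).trans (wlqNorm_add_le q hq.out w _ _)
    rw [map_add]
    exact temperedLpNorm_add_le p _ _
  smul_mem' := by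
    intro c f hf
    refine lt_of_le_of_lt ?_ (ENNReal.mul_lt_top (enorm_lt_top (x := c)) hf)
    refine (wlqNorm_mono q w fun i => ?_).trans (wlqNorm_const_mul q hq.out w _ _).le
    rw [map_smul]
    exact temperedLpNorm_smul_le p _ _

/-- `F` is a family of nonnegative `L^p` functions that belongs to `ℓ^q_w(I; L^p)`. -/
structure MemLqLp (w : I → ℝ) (p q : ℝ≥0∞) (F : I → RR d → ℝ) : Prop where
  nonneg : ∀ i x, 0 ≤ F i x
  memLp : ∀ i, MemLp (F i) p volume
  norm_lt_top : wlqNorm q w (fun i => eLpNorm (F i) p volume) < ⊤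

/-- `f` is `(F, φ)`-dominated: the smooth function `h` that represents the band-limited
distribution `𝓕⁻¹ (φ_i f^)` satisfies `|h| ≤ F_i`, for all `i`. -/
def IsDominated (φ : I → 𝓓(O, ℂ)) (F : I → RR d → ℝ) (f : FourierDist O) : Prop :=
  ∀ i, ∃ h : RR d → ℂ, ContDiff ℝ ∞ h ∧
    (∀ g : 𝓢(RR d, ℂ), localize (φ i) f g = ∫ x, h x * g x) ∧ ∀ x, ‖h x‖ ≤ F i x

/-- The `i`-th term `⟨f^ | φ_i g^⟩` of the extended inner product; the pairing is sesquilinear,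
hence the complex conjugate. -/
def pairingTerm (φ : I → 𝓓(O, ℂ)) (f : FourierDist O) (g : RR d → ℂ) (hg : ContDiff ℝ ∞ (𝓕 g))
    (i : I) : ℂ :=
  FourierDist.hat f (conjTest (mulSmooth (φ i) (𝓕 g) hg))

/-- The extended inner product `⟨f | g⟩_φ` is well-defined: its series converges absolutely. -/
def PairingConverges (φ : I → 𝓓(O, ℂ)) (f : FourierDist O) (g : RR d → ℂ)
    (hg : ContDiff ℝ ∞ (𝓕 g)) : Prop :=
  Summable fun i => ‖pairingTerm φ f g hg i‖

/-- The extended inner product `⟨f | g⟩_φ = ∑_i ⟨f^ | φ_i g^⟩`. -/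
def extPairing (φ : I → 𝓓(O, ℂ)) (f : FourierDist O) (g : RR d → ℂ) (hg : ContDiff ℝ ∞ (𝓕 g)) :
    ℂ :=
  ∑' i, pairingTerm φ f g hg i

end DecompositionSpaces

/-! ### Generalized shift-invariant systems -/

section Systems

/-- The translate `T_y g`. -/
def translate {d : ℕ} (y : RR d) (g : RR d → ℂ) : RR d → ℂ := fun x => g (x - y)

theorem memLp_translate {d : ℕ} (p : ℝ≥0∞) (y : RR d) {g : RR d → ℂ} (hg : MemLp g p volume) :
    MemLp (translate y g) p volume :=
  hg.comp_measurePreserving (measurePreserving_sub_right volume y)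

theorem contDiff_fourier_translate {d : ℕ} (y : RR d) {g : RR d → ℂ}
    (hg : ContDiff ℝ ∞ (𝓕 g)) : ContDiff ℝ ∞ (𝓕 (translate y g)) := by
  have h : 𝓕 (translate y g) = fun ξ => 𝐞 (inner ℝ (-y) ξ) • 𝓕 g ξ := by
    have := VectorFourier.fourierIntegral_comp_add_right 𝐞 (volume : Measure (RR d))
      (innerₗ (RR d)) g (-y)
    have h2 : translate y g = g ∘ fun x => x + -y := by
      funext x
      simp [translate, sub_eq_add_neg]
    rw [h2]
    exact this
  rw [h]
  simp_rw [Circle.smul_def, smul_eq_mul, Real.fourierChar_apply]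
  have h1 : ContDiff ℝ ∞ fun ξ : RR d => ((2 * Real.pi * inner ℝ (-y) ξ : ℝ) : ℂ) :=
    Complex.ofRealCLM.contDiff.comp (contDiff_const.mul (contDiff_const.inner ℝ contDiff_id))
  exact ((h1.mul contDiff_const).cexp).mul hg

/-- A generalized shift-invariant system on `ℝ^d` with generators `g_j` and lattices `C_j ℤ^d`:
the generators are in `L^1 ∩ L^2`, have smooth Fourier transforms, and satisfy
`A ≤ ∑_j |det C_j|⁻¹ |g_j^|² ≤ B` almost everywhere, for some `A, B > 0`. -/
structure GSISystem (d : ℕ) (J : Type*) where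
  /-- The lattice matrices. -/
  C : J → GL (Fin d) ℝ
  /-- The generators. -/
  g : J → RR d → ℂ
  memLp_one : ∀ j, MemLp (g j) 1 volume
  memLp_two : ∀ j, MemLp (g j) 2 volume
  contDiff_fourier : ∀ j, ContDiff ℝ ∞ (𝓕 (g j))
  bounds : ∃ A B : ℝ≥0, 0 < A ∧ 0 < B ∧ ∀ᵐ ξ : RR d,
    (A : ℝ≥0∞) ≤ ∑' j, ENNReal.ofReal (|(C j).1.det|⁻¹ * ‖𝓕 (g j) ξ‖ ^ 2) ∧
    ∑' j, ENNReal.ofReal (|(C j).1.det|⁻¹ * ‖𝓕 (g j) ξ‖ ^ 2) ≤ B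

variable {d : ℕ} {I J : Type*} {O : Opens (RR d)}

/-- The lattice point `C_j k`. -/
def GSISystem.node (G : GSISystem d J) (j : J) (k : Fin d → ℤ) : RR d :=
  Matrix.toEuclideanLin (G.C j).1 (WithLp.toLp 2 fun a => (k a : ℝ))

/-- The element `T_{C_j k} g_j` of the system, as a function. -/
def GSISystem.atom (G : GSISystem d J) (j : J) (k : Fin d → ℤ) : RR d → ℂ :=
  translate (G.node j k) (G.g j)

theorem GSISystem.contDiff_atom (G : GSISystem d J) (j : J) (k : Fin d → ℤ) :
    ContDiff ℝ ∞ (𝓕 (G.atom j k)) :=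
  contDiff_fourier_translate _ (G.contDiff_fourier j)

theorem GSISystem.memLp_atom (G : GSISystem d J) (j : J) (k : Fin d → ℤ) :
    MemLp (G.atom j k) 1 volume :=
  memLp_translate 1 _ (G.memLp_one j)

variable (O) in
/-- The element `T_{C_j k} g_j` of the system, as a Fourier distribution. -/
def GSISystem.atomZ (G : GSISystem d J) (j : J) (k : Fin d → ℤ) : FourierDist O :=
  restrictZ O (Lp.toTemperedDistribution ((G.memLp_atom j k).toLp (G.atom j k)))

/-- The discrete amalgam norm `‖f‖_{W(L^∞, ℓ^1)} = ∑_{n ∈ ℤ^d} ‖1_{n + [0,1]^d} f‖_{L^∞}`. -/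
def amalgamNorm (f : RR d → ℂ) : ℝ≥0∞ :=
  ∑' n : Fin d → ℤ,
    eLpNorm (Set.indicator {x : RR d | ∀ a, (n a : ℝ) ≤ x a ∧ x a ≤ n a + 1} f) ⊤ volume

/-- The matrix
`M_{i,j} = max {w_i / v_j, v_j / w_i} |det C_j|^{1/2} ‖(φ_i^∨ * g_j) ∘ C_j‖_{W(L^∞, ℓ^1)}`. -/
def GSISystem.schurMatrix (G : GSISystem d J) (φ : I → 𝓓(O, ℂ)) (w : I → ℝ) (v : J → ℝ)
    (i : I) (j : J) : ℝ≥0∞ :=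
  ENNReal.ofReal (max (w i / v j) (v j / w i) * |(G.C j).1.det| ^ (1 / 2 : ℝ)) *
    amalgamNorm fun x =>
      (convolution (𝓕⁻ (φ i : RR d → ℂ)) (G.g j) (ContinuousLinearMap.mul ℂ ℂ) volume)
        (Matrix.toEuclideanLin (G.C j).1 x)

/-- The system is `(w, v, φ)`-adapted: the matrix `M` is of Schur type. -/
def GSISystem.IsAdapted (G : GSISystem d J) (φ : I → 𝓓(O, ℂ)) (w : I → ℝ) (v : J → ℝ) : Prop :=
  schurNorm (G.schurMatrix φ w v) < ⊤

/-- The norm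
`‖c‖_{Y_v^{p,q}} = ‖(v_j |det C_j|^{1/p - 1/2} ‖(c_k^{(j)})_k‖_{ℓ^p})_j‖_{ℓ^q}`. -/
def GSISystem.coeffNorm (G : GSISystem d J) (v : J → ℝ) (p q : ℝ≥0∞)
    (c : J → (Fin d → ℤ) → ℂ) : ℝ≥0∞ :=
  wlqNorm q (fun j => v j * |(G.C j).1.det| ^ ((p⁻¹).toReal - 1 / 2))
    fun j => lqNorm p fun k => ‖c j k‖ₑ

/-- The coefficient space `Y_v^{p,q}`. -/
def GSISystem.CoeffSpace (G : GSISystem d J) (v : J → ℝ) (p q : ℝ≥0∞) [hp : Fact (1 ≤ p)]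
    [hq : Fact (1 ≤ q)] : Submodule ℂ (J → (Fin d → ℤ) → ℂ) where
  carrier := {c | G.coeffNorm v p q c < ⊤}
  zero_mem' := by
    change G.coeffNorm v p q 0 < ⊤
    unfold GSISystem.coeffNorm
    simp only [Pi.zero_apply, enorm_zero, lqNorm_zero p hp.out, wlqNorm_zero q hq.out]
    exact ENNReal.zero_lt_top
  add_mem' := by
    intro b c hb hc
    refine lt_of_le_of_lt ?_ (ENNReal.add_lt_top.2 ⟨hb, hc⟩)
    refine (wlqNorm_mono q _ fun j => ?_).trans (wlqNorm_add_le q hq.out _ _ _)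
    exact (lqNorm_mono p fun k => enorm_add_le _ _).trans (lqNorm_add_le p hp.out _ _)
  smul_mem' := by
    intro a c hc
    refine lt_of_le_of_lt ?_ (ENNReal.mul_lt_top (enorm_lt_top (x := a)) hc)
    refine (wlqNorm_mono q _ fun j => ?_).trans (wlqNorm_const_mul q hq.out _ _ _).le
    exact (lqNorm_mono p fun k => (enorm_smul a (c j k)).le).trans
      (lqNorm_const_mul p hp.out _ _).le

end Systems

end

end GSIFrame

open GSIFrame

/-! ### Schur's test and Minkowski's inequality for sequence and function norms -/

namespace GSIFrame

/-! Everything reduces to Schur's test on two levels. On the inner level, let W be the amalgam norm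
of g ∘ C. The kernel |g(x - C k)| on ℝ^d × ℤ^d has row sums at most W for almost every x, because x
- k visits each unit cube once, and column integrals at most |det C| W. So synthesis ℓ^p → L^p costs
|det C|^{1/p} W and the transposed correlation L^p → ℓ^p costs |det C|^{1-1/p} W
(`eLpNorm_tsum_lattice_le`, `lqNorm_lintegral_lattice_le`). This is used for g = 𝓕⁻¹φ_i * g_j. On
the outer level, the determinants and weights combine to the entries of M, and Schur's test for M or
its transpose gives the ℓ^q bounds (`lqNorm_matrix_le`).

All estimates are made for nonnegative majorants, so that convergence and norm bounds come together.
For synthesis the majorant is `majorant`. A test function on O meets only finitely many φ_i, so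
finiteness of each localized majorant gives absolute convergence against Z(O) and continuity of the
sum. For the coefficients it is `coeffMajorant`: φ_i ĝ vanishes off Q_i, so only the localizations
of f with index in i^* enter, and the cluster sums cost ‖Γ_Q‖ (`enormCoeff_coeffMajorant_le`).

Independence of the BAPU is Fubini for the double family f̂ applied to the conjugate of ψ_i φ_m ĝ.
Its absolute convergence follows from the uniform L^1 bound on 𝓕⁻¹ψ_i, moderateness of w and bounded
cluster size (`tsum_enorm_hat_conjTest_lt_top`).

For dominated sequences, a band-limited function is reproduced by a convolution kernel, so weak-star
convergence forces almost everywhere convergence of the representing functions, and the bound by F_i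
survives (`temperedLpNorm_localize_le_of_tendsto`). The family F also yields one coefficient array
in Y_v^{p,q} that dominates the coefficients of every f_n, so dominated convergence for series
applies to the pairing and to the synthesis. -/

theorem toReal_inv_mem {p : ℝ≥0∞} (hp : 1 ≤ p) : 0 ≤ (p⁻¹).toReal ∧ (p⁻¹).toReal ≤ 1 := by
  refine ⟨ENNReal.toReal_nonneg, ?_⟩
  have := (ENNReal.toReal_le_toReal (by simp; positivity) ENNReal.one_ne_top).2
    (ENNReal.inv_le_one.2 hp)
  simpa using this

/-- Schur's test for an integral operator with nonnegative kernel. -/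
theorem eLpNorm_kernel_le {X Y : Type*} [MeasurableSpace X] [MeasurableSpace Y] {μ : Measure X}
    {ν : Measure Y} (K : X → Y → ℝ≥0∞) (hK : ∀ x, AEMeasurable (K x) ν) (α β : ℝ≥0∞)
    (hαt : α ≠ ⊤) (hα : ∀ᵐ x ∂μ, ∫⁻ y, K x y ∂ν ≤ α) (hβ : ∀ᵐ y ∂ν, ∫⁻ x, K x y ∂μ ≤ β)
    (hswap : ∀ b : Y → ℝ≥0∞, AEMeasurable b ν →
      ∫⁻ x, ∫⁻ y, K x y * b y ∂ν ∂μ = ∫⁻ y, (∫⁻ x, K x y ∂μ) * b y ∂ν)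
    (a : Y → ℝ≥0∞) (ha : AEMeasurable a ν) (p : ℝ≥0∞) (hp : 1 ≤ p) :
    eLpNorm (fun x => ∫⁻ y, K x y * a y ∂ν) p μ
      ≤ α ^ (1 - (p⁻¹).toReal) * β ^ (p⁻¹).toReal * eLpNorm a p ν := by
  have hp0 : p ≠ 0 := (zero_lt_one.trans_le hp).ne'
  rcases eq_or_ne p ⊤ with rfl | hpt
  · simp only [ENNReal.inv_top, ENNReal.toReal_zero, sub_zero, ENNReal.rpow_one, ENNReal.rpow_zero,
      mul_one]
    rw [eLpNorm_exponent_top, eLpNorm_exponent_top]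
    refine eLpNormEssSup_le_of_ae_enorm_bound ?_
    filter_upwards [hα] with x hx
    rw [enorm_eq_self]
    calc ∫⁻ y, K x y * a y ∂ν ≤ ∫⁻ y, K x y * eLpNormEssSup a ν ∂ν := by
          refine lintegral_mono_ae ?_
          filter_upwards [enorm_ae_le_eLpNormEssSup a ν] with y hy
          rw [enorm_eq_self] at hy
          gcongr
      _ = (∫⁻ y, K x y ∂ν) * eLpNormEssSup a ν := lintegral_mul_const'' _ (hK x)
      _ ≤ _ := by gcongr
  · have hr : 0 < p.toReal := ENNReal.toReal_pos hp0 hpt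
    have hpi : (p⁻¹).toReal = p.toReal⁻¹ := ENNReal.toReal_inv p
    have hr1 : p.toReal⁻¹ ≤ 1 := hpi ▸ (toReal_inv_mem hp).2
    rw [eLpNorm_eq_lintegral_rpow_enorm_toReal hp0 hpt,
      eLpNorm_eq_lintegral_rpow_enorm_toReal hp0 hpt, hpi, one_div]
    simp only [enorm_eq_self]
    set r := p.toReal
    have key : ∀ᵐ x ∂μ, (∫⁻ y, K x y * a y ∂ν) ^ r ≤
        α ^ (r - 1) * ∫⁻ y, K x y * a y ^ r ∂ν := by
      filter_upwards [hα] with x hx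
      -- Hölder with weights 1 - 1/r and 1/r for the functions K and K a^r, since K^{1-1/r} (K
      -- a^r)^{1/r} = K a.
      have h1 : ∫⁻ y, K x y * a y ∂ν ≤
          (∫⁻ y, K x y ∂ν) ^ (1 - r⁻¹) * (∫⁻ y, K x y * a y ^ r ∂ν) ^ r⁻¹ := by
        have := ENNReal.lintegral_mul_norm_pow_le (hK x) ((hK x).mul (ha.pow_const r))
          (sub_nonneg.2 hr1) (inv_nonneg.2 hr.le) (by ring)
        refine le_trans (le_of_eq ?_) this
        congr 1 with y
        rw [Pi.mul_apply, ENNReal.mul_rpow_of_nonneg _ _ (inv_nonneg.2 hr.le), ENNReal.rpow_rpow_inv hr.ne',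
          ← mul_assoc, ← ENNReal.rpow_add_of_nonneg _ _ (sub_nonneg.2 hr1) (inv_nonneg.2 hr.le)]
        simp
      calc _ ≤ (α ^ (1 - r⁻¹) * (∫⁻ y, K x y * a y ^ r ∂ν) ^ r⁻¹) ^ r := by
            gcongr
            refine h1.trans ?_
            gcongr
        _ = _ := by
            rw [ENNReal.mul_rpow_of_nonneg _ _ hr.le, ENNReal.rpow_inv_rpow hr.ne',
              ← ENNReal.rpow_mul]
            congr 2
            field_simp
    have hr1' : 0 ≤ r - 1 := by
      have : 1 ≤ r := by
        rw [inv_le_one_iff₀] at hr1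
        rcases hr1 with h | h
        · linarith
        · exact h
      linarith
    calc (∫⁻ x, (∫⁻ y, K x y * a y ∂ν) ^ r ∂μ) ^ r⁻¹
        ≤ (α ^ (r - 1) * (β * ∫⁻ y, a y ^ r ∂ν)) ^ r⁻¹ := by
          gcongr
          calc _ ≤ ∫⁻ x, α ^ (r - 1) * ∫⁻ y, K x y * a y ^ r ∂ν ∂μ := lintegral_mono_ae key
            _ ≤ _ := by
              -- `hswap` takes the place of Tonelli, so neither σ-finiteness nor joint measurability
              -- of `K` is required.
              rw [lintegral_const_mul' _ _ (ENNReal.rpow_ne_top_of_nonneg hr1' hαt),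
                hswap _ (ha.pow_const r), ← lintegral_const_mul'' _ (ha.pow_const r)]
              refine mul_le_mul_right (lintegral_mono_ae ?_) _
              filter_upwards [hβ] with y hy
              gcongr
      _ = _ := by
          rw [ENNReal.mul_rpow_of_nonneg _ _ (inv_nonneg.2 hr.le),
            ENNReal.mul_rpow_of_nonneg _ _ (inv_nonneg.2 hr.le), ← ENNReal.rpow_mul, mul_assoc]
          congr 2
          field_simp

/-- Through the counting measure, bounds for sequence norms become instances of the statements about
`eLpNorm`. -/
theorem lqNorm_eq_eLpNorm {ι : Type*} [MeasurableSpace ι] [MeasurableSingletonClass ι] (q : ℝ≥0∞)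
    (hq : 1 ≤ q) (a : ι → ℝ≥0∞) (ha : Measurable a) :
    lqNorm q a = eLpNorm a q Measure.count := by
  unfold lqNorm
  split_ifs with h
  · rw [h, eLpNorm_exponent_top, eLpNormEssSup_count]
    simp
  · rw [eLpNorm_eq_lintegral_rpow_enorm_toReal (zero_lt_one.trans_le hq).ne' h,
      lintegral_count' (by simpa using ha.pow_const _), one_div]
    simp

/-- Minkowski's inequality for countable sums of nonnegative functions. -/
theorem eLpNorm_tsum_le {X ι : Type*} [MeasurableSpace X] {μ : Measure X} [Countable ι]
    (f : ι → X → ℝ≥0∞) (hf : ∀ i, AEMeasurable (f i) μ) (p : ℝ≥0∞) (hp : 1 ≤ p) :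
    eLpNorm (fun x => ∑' i, f i x) p μ ≤ ∑' i, eLpNorm (f i) p μ := by
  have hp0 : p ≠ 0 := (zero_lt_one.trans_le hp).ne'
  rcases eq_or_ne p ⊤ with rfl | hpt
  · simp only [eLpNorm_exponent_top]
    refine eLpNormEssSup_le_of_ae_enorm_bound ?_
    have : ∀ᵐ x ∂μ, ∀ i, ‖f i x‖ₑ ≤ eLpNormEssSup (f i) μ :=
      ae_all_iff.2 fun i => enorm_ae_le_eLpNormEssSup (f i) μ
    filter_upwards [this] with x hx
    rw [enorm_eq_self]
    exact ENNReal.tsum_le_tsum fun i => by simpa using hx i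
  · have hr : 0 < p.toReal := ENNReal.toReal_pos hp0 hpt
    have hsum : ∀ s : Finset ι, eLpNorm (fun x => ∑ i ∈ s, f i x) p μ ≤ ∑' i, eLpNorm (f i) p μ := by
      intro s
      have := eLpNorm_sum_le (s := s) (f := f) (μ := μ) (p := p)
        (fun i _ => (hf i).aestronglyMeasurable) hp
      rw [show (∑ i ∈ s, f i) = fun x => ∑ i ∈ s, f i x from by ext; simp] at this
      exact this.trans (ENNReal.sum_le_tsum s)
    simp only [eLpNorm_eq_lintegral_rpow_enorm_toReal hp0 hpt, one_div, enorm_eq_self] at hsum ⊢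
    rw [ENNReal.rpow_inv_le_iff hr]
    -- Powers commute with suprema in [0, ∞] and finite partial sums are directed, so the finite
    -- Minkowski inequality passes to the limit by monotone convergence.
    have h1 : ∀ x, (∑' i, f i x) ^ p.toReal = ⨆ s : Finset ι, (∑ i ∈ s, f i x) ^ p.toReal := by
      intro x
      rw [ENNReal.tsum_eq_iSup_sum]
      exact (ENNReal.orderIsoRpow p.toReal hr).map_iSup _
    simp_rw [h1]
    rw [lintegral_iSup_directed]
    · exact iSup_le fun s => (ENNReal.rpow_inv_le_iff hr).1 (hsum s)
    · intro s
      exact (Finset.aemeasurable_fun_sum s fun i _ => hf i).pow_const _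
    · intro s t
      classical
      refine ⟨s ∪ t, ?_, ?_⟩ <;>
      · intro x
        dsimp only
        gcongr
        first | exact Finset.subset_union_left | exact Finset.subset_union_right

theorem lqNorm_tsum_le {ι κ : Type*} [Countable ι] (f : ι → κ → ℝ≥0∞) (q : ℝ≥0∞)
    (hq : 1 ≤ q) : lqNorm q (fun k => ∑' i, f i k) ≤ ∑' i, lqNorm q (f i) := by
  let _ : MeasurableSpace κ := ⊤
  rw [lqNorm_eq_eLpNorm q hq _ measurable_from_top]
  refine (eLpNorm_tsum_le f (fun i => measurable_from_top.aemeasurable) q hq).trans_eq ?_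
  congr 1 with i
  rw [lqNorm_eq_eLpNorm q hq _ measurable_from_top]

/-- Schur's test for matrices. -/
theorem lqNorm_matrix_le {I J : Type*} [Countable I] [Countable J] (M : I → J → ℝ≥0∞)
    (hM : schurNorm M < ⊤) (a : J → ℝ≥0∞) (q : ℝ≥0∞) (hq : 1 ≤ q) :
    lqNorm q (fun i => ∑' j, M i j * a j) ≤ schurNorm M * lqNorm q a := by
  let _ : MeasurableSpace I := ⊤
  let _ : MeasurableSpace J := ⊤
  rw [lqNorm_eq_eLpNorm q hq _ measurable_from_top, lqNorm_eq_eLpNorm q hq _ measurable_from_top]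
  have := eLpNorm_kernel_le (μ := (Measure.count : Measure I)) (ν := (Measure.count : Measure J)) M
    (fun _ => measurable_from_top.aemeasurable) (schurNorm M) (schurNorm M) hM.ne
    (Eventually.of_forall fun i => by
      rw [lintegral_count]
      exact (le_iSup (fun i => ∑' j, M i j) i).trans (le_max_left _ _))
    (Eventually.of_forall fun j => by
      rw [lintegral_count]
      exact (le_iSup (fun j => ∑' i, M i j) j).trans (le_max_right _ _))
    (fun b _ => by
      simp only [lintegral_count]
      rw [ENNReal.tsum_comm]
      simp_rw [ENNReal.tsum_mul_right]) a measurable_from_top.aemeasurable q hq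
  simp only [lintegral_count] at this
  have hi := toReal_inv_mem hq
  rwa [← ENNReal.rpow_add_of_nonneg _ _ (by linarith) hi.1, sub_add_cancel, ENNReal.rpow_one] at this

/-! ### Unit cubes and the amalgam norm -/

/-- The point of `ℝ^d` with integer coordinates `n`. -/
noncomputable def intPoint {d : ℕ} (n : Fin d → ℤ) : RR d := WithLp.toLp 2 fun a => (n a : ℝ)

theorem intPoint_apply {d : ℕ} (n : Fin d → ℤ) (a : Fin d) : intPoint n a = n a := rfl

/-- The closed unit cube with lower corner `n`. -/
def unitCube {d : ℕ} (n : Fin d → ℤ) : Set (RR d) :=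
  {x : RR d | ∀ a, (n a : ℝ) ≤ x a ∧ x a ≤ n a + 1}

theorem measurableSet_unitCube {d : ℕ} (n : Fin d → ℤ) : MeasurableSet (unitCube n) := by
  have : unitCube n = ⋂ a, {x : RR d | (n a : ℝ) ≤ x a ∧ x a ≤ n a + 1} := by
    ext x; simp [unitCube]
  rw [this]
  refine MeasurableSet.iInter fun a => ?_
  have h : Measurable fun x : RR d => x a := by fun_prop
  exact (measurableSet_le measurable_const h).inter (measurableSet_le h measurable_const)

theorem volume_unitCube {d : ℕ} (n : Fin d → ℤ) : volume (unitCube n) = 1 := by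
  have h := (EuclideanSpace.volume_preserving_symm_measurableEquiv_toLp (Fin d))
  have : unitCube n = (MeasurableEquiv.toLp 2 (Fin d → ℝ)).symm ⁻¹'
      Set.Icc (fun a => (n a : ℝ)) (fun a => (n a : ℝ) + 1) := by
    ext x
    simp [unitCube, Pi.le_def, forall_and]
  rw [this, h.measure_preimage measurableSet_Icc.nullMeasurableSet, Real.volume_Icc_pi]
  simp

theorem floor_mem_unitCube {d : ℕ} (x : RR d) : x ∈ unitCube fun a => ⌊x a⌋ :=
  fun _ => ⟨Int.floor_le _, (Int.lt_floor_add_one _).le⟩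

theorem ae_enorm_le_of_mem_unitCube {d : ℕ} (f : RR d → ℂ) :
    ∀ᵐ x, ∀ n, x ∈ unitCube n → ‖f x‖ₑ ≤ eLpNorm ((unitCube n).indicator f) ⊤ volume := by
  refine ae_all_iff.2 fun n => ?_
  filter_upwards [enorm_ae_le_eLpNormEssSup ((unitCube n).indicator f) volume] with x hx hn
  rwa [Set.indicator_of_mem hn, ← eLpNorm_exponent_top] at hx

theorem amalgamNorm_eq {d : ℕ} (f : RR d → ℂ) :
    amalgamNorm f = ∑' n, eLpNorm ((unitCube n).indicator f) ⊤ volume := rfl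

/-- The point x - k lies in the cube with corner ⌊x⌋ - k, and k ↦ ⌊x⌋ - k permutes ℤ^d. Each summand
is thus bounded by one term of the amalgam norm, and each term is used once. -/
theorem ae_tsum_enorm_sub_intPoint_le {d : ℕ} (f : RR d → ℂ) :
    ∀ᵐ x, ∑' k, ‖f (x - intPoint k)‖ₑ ≤ amalgamNorm f := by
  have : ∀ᵐ x, ∀ k n, x - intPoint k ∈ unitCube n →
      ‖f (x - intPoint k)‖ₑ ≤ eLpNorm ((unitCube n).indicator f) ⊤ volume :=
    ae_all_iff.2 fun k => (measurePreserving_sub_right volume (intPoint k)).quasiMeasurePreserving.ae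
      (ae_enorm_le_of_mem_unitCube f)
  filter_upwards [this] with x hx
  rw [amalgamNorm_eq, ← (Equiv.subLeft fun a => ⌊x a⌋).tsum_eq
    fun n => eLpNorm ((unitCube n).indicator f) ⊤ volume]
  refine ENNReal.tsum_le_tsum fun k => hx k _ ?_
  have : (Equiv.subLeft fun a => ⌊x a⌋) k = fun a => ⌊(x - intPoint k) a⌋ := by
    ext a
    simp [intPoint_apply]
  rw [this]
  exact floor_mem_unitCube _

/-- The cubes cover ℝ^d and have volume one; their overlaps do no harm in an upper bound. -/
theorem lintegral_enorm_le_amalgamNorm {d : ℕ} (f : RR d → ℂ) :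
    ∫⁻ x, ‖f x‖ₑ ≤ amalgamNorm f := by
  have hU : ⋃ n : Fin d → ℤ, unitCube n = Set.univ :=
    Set.eq_univ_of_forall fun x => Set.mem_iUnion.2 ⟨_, floor_mem_unitCube x⟩
  rw [← setLIntegral_univ, ← hU]
  refine (lintegral_iUnion_le _ _).trans (ENNReal.tsum_le_tsum fun n => ?_)
  calc ∫⁻ x in unitCube n, ‖f x‖ₑ
      ≤ ∫⁻ _ in unitCube n, eLpNorm ((unitCube n).indicator f) ⊤ volume := by
        refine setLIntegral_mono_ae' (measurableSet_unitCube n) ?_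
        filter_upwards [ae_enorm_le_of_mem_unitCube f] with x hx using hx n
    _ = _ := by
      rw [setLIntegral_const, volume_unitCube, mul_one]
      rfl

/-! ### Synthesis and correlation with lattice translates -/

section Lattice

variable {d : ℕ} (C : GL (Fin d) ℝ)

theorem det_toEuclideanLin : LinearMap.det (Matrix.toEuclideanLin C.1) = C.1.det := by
  rw [Matrix.toEuclideanLin_eq_toLin_orthonormal, LinearMap.det_toLin]

theorem det_ne_zero' : C.1.det ≠ 0 := ((Matrix.isUnit_iff_isUnit_det _).1 C.isUnit).ne_zero

theorem abs_det_pos : 0 < |C.1.det| := abs_pos.2 (det_ne_zero' C)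

theorem toEuclideanLin_inv_apply (x : RR d) :
    Matrix.toEuclideanLin C.1 (Matrix.toEuclideanLin (C⁻¹ : GL (Fin d) ℝ).1 x) = x := by
  simp [Matrix.toLpLin_apply, Matrix.mulVec_mulVec, det_ne_zero' C]

theorem lintegral_comp_toEuclideanLin (f : RR d → ℝ≥0∞) (hf : AEMeasurable f) :
    ∫⁻ x, f x = ENNReal.ofReal |C.1.det| * ∫⁻ x, f (Matrix.toEuclideanLin C.1 x) := by
  have hd : LinearMap.det (Matrix.toEuclideanLin C.1) ≠ 0 := by
    rw [det_toEuclideanLin]; exact det_ne_zero' C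
  have hmap := Measure.map_linearMap_addHaar_eq_smul_addHaar (volume : Measure (RR d)) hd
  have hm : Measurable (Matrix.toEuclideanLin C.1) :=
    (LinearMap.continuous_of_finiteDimensional _).measurable
  rw [← lintegral_map' (by rw [hmap]; exact hf.smul_measure _) hm.aemeasurable, hmap,
    lintegral_smul_measure, smul_eq_mul, ← mul_assoc, ← ENNReal.ofReal_mul (abs_nonneg _),
    det_toEuclideanLin, ← abs_mul, mul_inv_cancel₀ (det_ne_zero' C)]
  simp

/-- The row bound of the lattice kernel: the integer bound for g ∘ C, read at C⁻¹x. Preimages of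
null sets under C⁻¹ are null. -/
theorem ae_tsum_enorm_lattice_le (g : RR d → ℂ) :
    ∀ᵐ x, ∑' k, ‖g (x - Matrix.toEuclideanLin C.1 (intPoint k))‖ₑ ≤
      amalgamNorm fun x => g (Matrix.toEuclideanLin C.1 x) := by
  have hd : LinearMap.det (Matrix.toEuclideanLin (C⁻¹ : GL (Fin d) ℝ).1) ≠ 0 := by
    rw [det_toEuclideanLin]; exact det_ne_zero' _
  have hm := Measure.map_linearMap_addHaar_eq_smul_addHaar (volume : Measure (RR d)) hd
  have hq : Measure.QuasiMeasurePreserving (Matrix.toEuclideanLin (C⁻¹ : GL (Fin d) ℝ).1)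
      (volume : Measure (RR d)) volume :=
    ⟨(LinearMap.continuous_of_finiteDimensional _).measurable, by
      rw [hm]; exact Measure.smul_absolutelyContinuous⟩
  filter_upwards [hq.ae (ae_tsum_enorm_sub_intPoint_le fun x => g (Matrix.toEuclideanLin C.1 x))]
    with x hx
  simpa only [map_sub, toEuclideanLin_inv_apply] using hx

/-- The column bound of the lattice kernel: substituting x ↦ C x produces the factor |det C|, the
only asymmetry between rows and columns. -/
theorem lintegral_enorm_lattice_le (g : RR d → ℂ) (hg : AEStronglyMeasurable g) (y : RR d) :
    ∫⁻ x, ‖g (x - y)‖ₑ ≤ ENNReal.ofReal |C.1.det| *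
      amalgamNorm fun x => g (Matrix.toEuclideanLin C.1 x) := by
  rw [lintegral_sub_right_eq_self (fun x => ‖g x‖ₑ), lintegral_comp_toEuclideanLin C _ hg.enorm]
  gcongr
  exact lintegral_enorm_le_amalgamNorm fun x => g (Matrix.toEuclideanLin C.1 x)

theorem AEStronglyMeasurable.comp_sub {g : RR d → ℂ} (hg : AEStronglyMeasurable g) (y : RR d) :
    AEStronglyMeasurable fun x => g (x - y) :=
  hg.comp_measurePreserving (measurePreserving_sub_right volume y)

/-- The `L^p` bound for synthesis with lattice translates. -/
theorem eLpNorm_tsum_lattice_le (g : RR d → ℂ) (hg : AEStronglyMeasurable g)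
    (hW : (amalgamNorm fun x => g (Matrix.toEuclideanLin C.1 x)) ≠ ⊤)
    (a : (Fin d → ℤ) → ℝ≥0∞) (p : ℝ≥0∞) (hp : 1 ≤ p) :
    eLpNorm (fun x => ∑' k, a k * ‖g (x - Matrix.toEuclideanLin C.1 (intPoint k))‖ₑ) p volume ≤
      ENNReal.ofReal (|C.1.det| ^ (p⁻¹).toReal) *
        (amalgamNorm fun x => g (Matrix.toEuclideanLin C.1 x)) * lqNorm p a := by
  have hi := toReal_inv_mem hp
  have hgk := fun k => (AEStronglyMeasurable.comp_sub hg
    (Matrix.toEuclideanLin C.1 (intPoint k))).enorm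
  -- Rows are bounded by W and columns by |det C| W, so the constant is W^{1-1/p} (|det C| W)^{1/p}.
  have := eLpNorm_kernel_le (μ := (volume : Measure (RR d)))
    (ν := (Measure.count : Measure (Fin d → ℤ)))
    (fun x k => ‖g (x - Matrix.toEuclideanLin C.1 (intPoint k))‖ₑ)
    (fun _ => (Measurable.of_discrete).aemeasurable)
    _ _ hW (by simpa only [lintegral_count] using ae_tsum_enorm_lattice_le C g)
    (Eventually.of_forall fun k => lintegral_enorm_lattice_le C g hg _)
    (fun b _ => by
      simp only [lintegral_count]
      rw [lintegral_tsum fun k => (hgk k).mul_const _]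
      congr 1 with k
      rw [lintegral_mul_const'' _ (hgk k)]) a Measurable.of_discrete.aemeasurable p hp
  simp only [lintegral_count] at this
  rw [lqNorm_eq_eLpNorm p hp _ Measurable.of_discrete]
  simp_rw [mul_comm (a _)]
  refine this.trans_eq ?_
  rw [ENNReal.mul_rpow_of_nonneg _ _ hi.1, ENNReal.ofReal_rpow_of_nonneg (abs_nonneg _) hi.1,
    mul_left_comm, ← ENNReal.rpow_add_of_nonneg _ _ (by linarith) hi.1, sub_add_cancel,
    ENNReal.rpow_one]

/-- The `ℓ^p` bound for the correlation with lattice translates. -/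
theorem lqNorm_lintegral_lattice_le (g : RR d → ℂ) (hg : AEStronglyMeasurable g)
    (hW : (amalgamNorm fun x => g (Matrix.toEuclideanLin C.1 x)) ≠ ⊤)
    (F : RR d → ℝ≥0∞) (hF : AEMeasurable F) (p : ℝ≥0∞) (hp : 1 ≤ p) :
    lqNorm p (fun k => ∫⁻ x, F x * ‖g (x - Matrix.toEuclideanLin C.1 (intPoint k))‖ₑ) ≤
      ENNReal.ofReal (|C.1.det| ^ (1 - (p⁻¹).toReal)) *
        (amalgamNorm fun x => g (Matrix.toEuclideanLin C.1 x)) * eLpNorm F p volume := by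
  have hi := toReal_inv_mem hp
  have hgk := fun k => (AEStronglyMeasurable.comp_sub hg
    (Matrix.toEuclideanLin C.1 (intPoint k))).enorm
  -- Transposing the kernel exchanges the two bounds and moves the determinant to the power 1 - 1/p.
  have := eLpNorm_kernel_le (μ := (Measure.count : Measure (Fin d → ℤ)))
    (ν := (volume : Measure (RR d)))
    (fun k x => ‖g (x - Matrix.toEuclideanLin C.1 (intPoint k))‖ₑ)
    hgk _ _ (ENNReal.mul_ne_top ENNReal.ofReal_ne_top hW)
    (Eventually.of_forall fun k => lintegral_enorm_lattice_le C g hg _)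
    (by simpa only [lintegral_count] using ae_tsum_enorm_lattice_le C g)
    (fun b hb => by
      simp only [lintegral_count]
      simp_rw [← ENNReal.tsum_mul_right]
      exact (lintegral_tsum fun k => (hgk k).mul hb).symm) F hF p hp
  rw [lqNorm_eq_eLpNorm p hp _ Measurable.of_discrete]
  simp_rw [mul_comm (F _)]
  refine this.trans_eq ?_
  have h1 : 0 ≤ 1 - (p⁻¹).toReal := by linarith
  rw [ENNReal.mul_rpow_of_nonneg _ _ h1, ENNReal.ofReal_rpow_of_nonneg (abs_nonneg _) h1,
    mul_assoc (ENNReal.ofReal _), ← ENNReal.rpow_add_of_nonneg _ _ h1 hi.1, sub_add_cancel,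
    ENNReal.rpow_one]

end Lattice

end GSIFrame

/-! ### Admissible covers, partitions of unity and the clustering map -/

namespace GSIFrame

theorem le_lqNorm {ι : Type*} (q : ℝ≥0∞) (hq : 1 ≤ q) (a : ι → ℝ≥0∞) (i : ι) :
    a i ≤ lqNorm q a := by
  unfold lqNorm
  split_ifs with h
  · exact le_iSup a i
  · have hr : 0 < q.toReal := by linarith [one_le_toReal hq h]
    rw [ENNReal.le_rpow_inv_iff hr]
    exact ENNReal.le_tsum i

variable {d : ℕ} {I : Type*} {O : Opens (RR d)} {Q : I → Set (RR d)} {φ : I → 𝓓(O, ℂ)}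

theorem IsAdmissibleCover.subset (hQ : IsAdmissibleCover O Q) (i : I) : Q i ⊆ O :=
  hQ.iUnion_eq ▸ Set.subset_iUnion Q i

theorem IsAdmissibleCover.finite_cluster (hQ : IsAdmissibleCover O Q) (i : I) :
    (cluster Q i).Finite := by
  obtain ⟨N, hN⟩ := hQ.card_cluster_le
  exact Set.finite_of_encard_le_coe (hN i)

/-- The cluster `i^*` as a finite set. -/
noncomputable def IsAdmissibleCover.clusterFinset (hQ : IsAdmissibleCover O Q) (i : I) : Finset I :=
  (hQ.finite_cluster i).toFinset

theorem IsAdmissibleCover.mem_clusterFinset (hQ : IsAdmissibleCover O Q) {i l : I} :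
    l ∈ hQ.clusterFinset i ↔ l ∈ cluster Q i := Set.Finite.mem_toFinset _

theorem mem_cluster_comm {i l : I} : l ∈ cluster Q i ↔ i ∈ cluster Q l := by
  simp only [cluster, Set.mem_ofPred_eq, Set.inter_comm]

theorem IsAdmissibleCover.exists_card_le (hQ : IsAdmissibleCover O Q) :
    ∃ N : ℕ, ∀ i, (hQ.clusterFinset i).card ≤ N := by
  obtain ⟨N, hN⟩ := hQ.card_cluster_le
  refine ⟨N, fun i => ?_⟩
  have := hN i
  rw [(hQ.finite_cluster i).encard_eq_coe_toFinset_card] at this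
  exact_mod_cast this

theorem IsAdmissibleCover.clusterMap_eq (hQ : IsAdmissibleCover O Q) (c : I → ℂ) (i : I) :
    clusterMap Q c i = ∑ l ∈ hQ.clusterFinset i, c l :=
  finsum_mem_eq_finite_toFinset_sum _ (hQ.finite_cluster i)

theorem testFunction_eq_zero (χ : 𝓓(O, ℂ)) {ξ : RR d} (hξ : ξ ∉ O) : χ ξ = 0 := by
  by_contra h
  exact hξ (χ.tsupport_subset (subset_tsupport _ h))

theorem IsBAPU.mem_of_ne_zero (hφ : IsBAPU Q φ) {i : I} {ξ : RR d} (h : φ i ξ ≠ 0) : ξ ∈ Q i := by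
  by_contra hξ
  refine h (hφ.eq_zero i ξ ?_ hξ)
  by_contra hO
  exact h (testFunction_eq_zero _ hO)

theorem IsBAPU.exists_ne_zero (hφ : IsBAPU Q φ) {ξ : RR d} (h : ξ ∈ O) : ∃ i, φ i ξ ≠ 0 := by
  by_contra! h0
  have h1 : HasSum (fun i => φ i ξ) 0 := by simp only [h0, hasSum_zero]
  exact one_ne_zero ((hφ.hasSum_one ξ h).unique h1)

theorem IsBAPU.eq_zero_of_notMem_cluster (hφ : IsBAPU Q φ) {i l : I} (h : l ∉ cluster Q i)
    {ξ : RR d} (hξ : ξ ∈ Q i) : φ l ξ = 0 := by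
  by_contra h0
  exact h ⟨ξ, hφ.mem_of_ne_zero h0, hξ⟩

theorem IsBAPU.sum_eq_one (hφ : IsBAPU Q φ) (s : Finset I) {ξ : RR d} (hξ : ξ ∈ O)
    (hs : ∀ i ∉ s, φ i ξ = 0) : ∑ i ∈ s, φ i ξ = 1 :=
  (hasSum_sum_of_ne_finset_zero hs).unique (hφ.hasSum_one ξ hξ)

theorem IsBAPU.sum_cluster_eq_one (hQ : IsAdmissibleCover O Q) (hφ : IsBAPU Q φ) {i : I} {ξ : RR d}
    (hξ : ξ ∈ Q i) : ∑ l ∈ hQ.clusterFinset i, φ l ξ = 1 :=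
  hφ.sum_eq_one _ (hQ.subset i hξ) fun _ hl =>
    hφ.eq_zero_of_notMem_cluster (mt hQ.mem_clusterFinset.2 hl) hξ

theorem isOpen_ne_zero (χ : 𝓓(O, ℂ)) : IsOpen {ξ | χ ξ ≠ 0} :=
  isOpen_ne_fun χ.continuous continuous_const

/-- The index set of an admissible cover with a partition of unity is countable. -/
theorem IsBAPU.countable (hQ : IsAdmissibleCover O Q) (hφ : IsBAPU Q φ) : Countable I := by
  -- By second countability, countably many of the sets {φ_l ≠ 0} cover O. Every Q_i is nonempty and
  -- so meets one of them, which puts i into one of countably many finite clusters.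
  obtain ⟨T, hT, hU⟩ := TopologicalSpace.isOpen_iUnion_countable (fun i => {ξ | φ i ξ ≠ 0})
    fun i => isOpen_ne_zero (φ i)
  have : (Set.univ : Set I) ⊆ ⋃ l ∈ T, cluster Q l := by
    intro i _
    obtain ⟨ξ, hξ⟩ := hQ.nonempty i
    obtain ⟨l, hl⟩ := hφ.exists_ne_zero (hQ.subset i hξ)
    have h1 : ξ ∈ ⋃ i, {ξ | φ i ξ ≠ 0} := Set.mem_iUnion.2 ⟨l, hl⟩
    rw [← hU] at h1
    simp only [Set.mem_iUnion] at h1 ⊢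
    obtain ⟨m, hm, h⟩ := h1
    exact ⟨m, hm, ξ, hξ, hφ.mem_of_ne_zero h⟩
  exact Set.countable_univ_iff.1
    ((hT.biUnion fun l _ => (hQ.finite_cluster l).countable).mono this)

/-- A compact subset of `O` meets the supports of only finitely many members of a partition of
unity. -/
theorem IsBAPU.exists_finset (hQ : IsAdmissibleCover O Q) (hφ : IsBAPU Q φ) {K : Set (RR d)}
    (hK : IsCompact K) (hKO : K ⊆ O) : ∃ s : Finset I, ∀ i ∉ s, ∀ ξ ∈ K, φ i ξ = 0 := by
  classical
  obtain ⟨t, ht⟩ := hK.elim_finite_subcover (fun i => {ξ | φ i ξ ≠ 0})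
    (fun i => isOpen_ne_zero (φ i)) fun ξ hξ => Set.mem_iUnion.2 (hφ.exists_ne_zero (hKO hξ))
  -- If φ_i is nonzero somewhere on K, then Q_i meets Q_l for some l in the finite subcover, so i
  -- lies in a finite union of clusters.
  refine ⟨t.biUnion hQ.clusterFinset, fun i hi ξ hξ => ?_⟩
  obtain ⟨l, hl, h⟩ := Set.mem_iUnion₂.1 (ht hξ)
  by_contra h0
  exact hi (Finset.mem_biUnion.2 ⟨l, hl, hQ.mem_clusterFinset.2
    ⟨ξ, hφ.mem_of_ne_zero h0, hφ.mem_of_ne_zero h⟩⟩)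

variable {w : I → ℝ}

theorem IsModerateWeight.exists_le (hw : IsModerateWeight Q w) :
    ∃ K : ℝ≥0, ∀ i, ∀ l ∈ cluster Q i,
      ENNReal.ofReal (w i) ≤ K * ENNReal.ofReal (w l) := by
  obtain ⟨K, hK⟩ := hw.moderate
  refine ⟨K.toNNReal, fun i l hl => ?_⟩
  have h1 := hK i l hl
  rw [div_le_iff₀ (hw.pos l)] at h1
  have h2 := ENNReal.ofReal_le_ofReal h1
  rwa [ENNReal.ofReal_mul' (hw.pos l).le] at h2

/-- Schur's test for the matrix that equals the moderateness constant K when l ∈ i^* and zero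
otherwise: rows have at most N nonzero entries, and the neighbour relation is symmetric. The
constant K pays for replacing w_i by w_l. -/
theorem clusterNorm_lt_top (hQ : IsAdmissibleCover O Q) (hφ : IsBAPU Q φ)
    (hw : IsModerateWeight Q w) (q : ℝ≥0∞) (hq : 1 ≤ q) : clusterNorm Q w q < ⊤ := by
  classical
  have : Countable I := hφ.countable hQ
  obtain ⟨K, hK⟩ := hw.exists_le
  obtain ⟨N, hN⟩ := hQ.exists_card_le
  let M : I → I → ℝ≥0∞ := fun i l => if l ∈ hQ.clusterFinset i then (K : ℝ≥0∞) else 0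
  have hM1 : ∀ i, ∑' l, M i l ≤ N * K := by
    intro i
    rw [tsum_eq_sum (s := hQ.clusterFinset i) fun l hl => if_neg hl,
      Finset.sum_congr rfl fun l hl => if_pos hl, Finset.sum_const, nsmul_eq_mul]
    gcongr
    exact hN i
  have hsymm : ∀ i l, M i l = M l i := by
    intro i l
    simp only [M, hQ.mem_clusterFinset]
    rw [mem_cluster_comm]
  have hM : schurNorm M ≤ N * K :=
    max_le (iSup_le hM1) (iSup_le fun j => by simpa only [hsymm _ j] using hM1 j)
  have hM' : schurNorm M < ⊤ :=
    hM.trans_lt (ENNReal.mul_lt_top (ENNReal.natCast_lt_top N) ENNReal.coe_lt_top)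
  refine lt_of_le_of_lt (iSup₂_le fun c hc => ?_) hM'
  calc wlqNorm q w (fun i => ‖clusterMap Q c i‖ₑ)
      ≤ lqNorm q (fun i => ∑' l, M i l * (ENNReal.ofReal (w l) * ‖c l‖ₑ)) := by
        refine lqNorm_mono q fun i => ?_
        beta_reduce
        rw [hQ.clusterMap_eq, tsum_eq_sum (s := hQ.clusterFinset i) fun l hl => by simp [M, hl]]
        refine (mul_le_mul_right (enorm_sum_le _ _) _).trans ?_
        rw [Finset.mul_sum]
        refine Finset.sum_le_sum fun l hl => ?_
        simp only [M, if_pos hl, ← mul_assoc]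
        gcongr
        exact hK i l (hQ.mem_clusterFinset.1 hl)
    _ ≤ schurNorm M * lqNorm q (fun l => ENNReal.ofReal (w l) * ‖c l‖ₑ) :=
        lqNorm_matrix_le M hM' _ q hq
    _ ≤ schurNorm M * 1 := by gcongr; exact hc
    _ = _ := mul_one _

/-- `clusterNorm` is a supremum over complex sequences of norm at most one, so a family in [0, ∞]
must first be shown finite and divided by its norm t, with t = 0 treated apart. Nonnegativity
excludes cancellation in the clustering map. -/
theorem wlqNorm_sum_cluster_le (hQ : IsAdmissibleCover O Q) (hw : ∀ i, 0 < w i) (q : ℝ≥0∞)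
    (hq : 1 ≤ q) (a : I → ℝ≥0∞) (ha : wlqNorm q w a < ⊤) :
    wlqNorm q w (fun i => ∑ l ∈ hQ.clusterFinset i, a l) ≤ clusterNorm Q w q * wlqNorm q w a := by
  have hle : ∀ i, ENNReal.ofReal (w i) * a i ≤ wlqNorm q w a := fun i => le_lqNorm q hq _ i
  have hwi : ∀ i, ENNReal.ofReal (w i) ≠ 0 := fun i => by simpa using hw i
  have hat : ∀ i, a i ≠ ⊤ := fun i h => by
    have := hle i
    rw [h, ENNReal.mul_top (hwi i)] at this
    exact (this.trans_lt ha).ne rfl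
  set t := wlqNorm q w a
  rcases eq_or_ne t 0 with ht | ht
  · have h0 : ∀ i, a i = 0 := fun i => by
      have := hle i
      rw [ht, nonpos_iff_eq_zero, mul_eq_zero] at this
      exact this.resolve_left (hwi i)
    simp only [h0, Finset.sum_const_zero]
    rw [wlqNorm_zero q hq]
    exact zero_le
  · let c : I → ℂ := fun i => ((t⁻¹ * a i).toReal : ℂ)
    have hc : ∀ i, ‖c i‖ₑ = t⁻¹ * a i := fun i => by
      have : t⁻¹ * a i ≠ ⊤ := ENNReal.mul_ne_top (ENNReal.inv_ne_top.2 ht) (hat i)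
      rw [← ofReal_norm, Complex.norm_real, Real.norm_of_nonneg ENNReal.toReal_nonneg,
        ENNReal.ofReal_toReal this]
    have hG : ∀ i, ‖clusterMap Q c i‖ₑ = t⁻¹ * ∑ l ∈ hQ.clusterFinset i, a l := fun i => by
      rw [hQ.clusterMap_eq, Finset.mul_sum, ← ofReal_norm]
      simp only [c]
      rw [← Complex.ofReal_sum, Complex.norm_real, Real.norm_of_nonneg
        (Finset.sum_nonneg fun _ _ => ENNReal.toReal_nonneg), ← ENNReal.toReal_sum, ENNReal.ofReal_toReal]
      · exact (ENNReal.sum_lt_top.2 fun l _ =>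
          ENNReal.mul_lt_top (ENNReal.inv_lt_top.2 ht.bot_lt) (hat l).lt_top).ne
      · exact fun l _ => ENNReal.mul_ne_top (ENNReal.inv_ne_top.2 ht) (hat l)
    have h1 : wlqNorm q w (fun i => ‖c i‖ₑ) ≤ 1 := by
      simp only [hc]
      rw [wlqNorm_const_mul q hq, ENNReal.inv_mul_cancel ht ha.ne]
    have h2 : t⁻¹ * wlqNorm q w (fun i => ∑ l ∈ hQ.clusterFinset i, a l) ≤ clusterNorm Q w q := by
      rw [← wlqNorm_const_mul q hq]
      simp only [← hG]
      exact le_iSup₂ (f := fun (c : I → ℂ) (_ : wlqNorm q w (fun i => ‖c i‖ₑ) ≤ 1) =>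
        wlqNorm q w (fun i => ‖clusterMap Q c i‖ₑ)) c h1
    rw [mul_comm, ← div_eq_mul_inv] at h2
    exact (ENNReal.div_le_iff ht ha.ne).1 h2

end GSIFrame

/-! ### Band-pass filtering and localization on the Fourier side -/

namespace GSIFrame

variable {d : ℕ} {O : Opens (RR d)}

theorem toSchwartz_apply (χ : 𝓓(O, ℂ)) (x : RR d) : toSchwartz χ x = χ x := rfl

theorem mulTest_apply (φ : 𝓓(O, ℂ)) (g : 𝓢(RR d, ℂ)) (x : RR d) : mulTest φ g x = φ x * g x := rfl

theorem mulSmooth_apply (φ : 𝓓(O, ℂ)) (G : RR d → ℂ) (hG : ContDiff ℝ ∞ G) (x : RR d) :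
    mulSmooth φ G hG x = φ x * G x := rfl

theorem conjTest_apply (φ : 𝓓(O, ℂ)) (x : RR d) : conjTest φ x = starRingEnd ℂ (φ x) := by
  simp [conjTest]

theorem localize_apply (φ : 𝓓(O, ℂ)) (f : FourierDist O) (g : 𝓢(RR d, ℂ)) :
    localize φ f g = FourierDist.hat f (mulTest φ (𝓕⁻ g)) := rfl

theorem hat_mulTest (φ : 𝓓(O, ℂ)) (f : FourierDist O) (g : 𝓢(RR d, ℂ)) :
    FourierDist.hat f (mulTest φ g) = localize φ f (𝓕 g) := by
  rw [localize_apply, FourierPair.fourierInv_fourier_eq]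

theorem hat_restrictZ (T : 𝓢'(RR d, ℂ)) (χ : 𝓓(O, ℂ)) :
    FourierDist.hat (restrictZ O T) χ = T (𝓕 (toSchwartz χ)) := rfl

/-- The band-pass filtered function `𝓕⁻¹ φ * a`. -/
noncomputable def bandpass (φ : 𝓓(O, ℂ)) (a : RR d → ℂ) : RR d → ℂ :=
  convolution (𝓕⁻ (φ : RR d → ℂ)) a (ContinuousLinearMap.mul ℂ ℂ) volume

theorem fourierInv_test_eq (φ : 𝓓(O, ℂ)) : 𝓕⁻ (φ : RR d → ℂ) = ⇑(𝓕⁻ (toSchwartz φ) : 𝓢(RR d, ℂ)) :=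
  (SchwartzMap.fourierInv_coe (toSchwartz φ)).symm

theorem fourier_test_eq (φ : 𝓓(O, ℂ)) : 𝓕 (φ : RR d → ℂ) = ⇑(𝓕 (toSchwartz φ) : 𝓢(RR d, ℂ)) :=
  (SchwartzMap.fourier_coe (toSchwartz φ)).symm

theorem integrable_fourierInv_test (φ : 𝓓(O, ℂ)) : Integrable (𝓕⁻ (φ : RR d → ℂ)) := by
  rw [fourierInv_test_eq]
  exact (𝓕⁻ (toSchwartz φ) : 𝓢(RR d, ℂ)).integrable

theorem integrable_bandpass (φ : 𝓓(O, ℂ)) {a : RR d → ℂ} (ha : Integrable a) :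
    Integrable (bandpass φ a) :=
  (integrable_fourierInv_test φ).integrable_convolution _ ha

theorem continuous_bandpass (φ : 𝓓(O, ℂ)) {a : RR d → ℂ} (ha : Integrable a) :
    Continuous (bandpass φ a) := by
  refine BddAbove.continuous_convolution_left_of_integrable _ ?_ ?_ ha
  · rw [fourierInv_test_eq]
    refine ⟨SchwartzMap.seminorm ℂ 0 0 (𝓕⁻ (toSchwartz φ) : 𝓢(RR d, ℂ)), ?_⟩
    rintro _ ⟨x, rfl⟩
    exact SchwartzMap.norm_le_seminorm ℂ _ x
  · rw [fourierInv_test_eq]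
    exact (𝓕⁻ (toSchwartz φ) : 𝓢(RR d, ℂ)).continuous

theorem fourier_bandpass (φ : 𝓓(O, ℂ)) {a : RR d → ℂ} (ha : Integrable a) (ξ : RR d) :
    𝓕 (bandpass φ a) ξ = φ ξ * 𝓕 a ξ := by
  rw [bandpass, Real.fourier_mul_convolution_eq (integrable_fourierInv_test φ) ha]
  rw [fourierInv_test_eq, ← SchwartzMap.fourier_coe, FourierInvPair.fourier_fourierInv_eq]
  rfl

theorem bandpass_translate (φ : 𝓓(O, ℂ)) (a : RR d → ℂ) (y : RR d) :
    bandpass φ (translate y a) = translate y (bandpass φ a) := by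
  ext x
  simp only [bandpass, translate, convolution_def]
  congr 1 with t
  rw [sub_right_comm]

theorem integral_fourier_mul_schwartz {a : RR d → ℂ} (ha : Integrable a) (g : 𝓢(RR d, ℂ)) :
    ∫ x, 𝓕 a x * g x = ∫ x, a x * (𝓕 g : 𝓢(RR d, ℂ)) x := by
  have := VectorFourier.integral_fourierIntegral_smul_eq_flip (L := innerₗ (RR d))
    Real.continuous_fourierChar continuous_inner ha g.integrable (μ := volume) (ν := volume)
  rw [flip_innerₗ] at this
  simp only [smul_eq_mul] at this
  rw [SchwartzMap.fourier_coe]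
  exact this

/-- The multiplication formula ∫ â g = ∫ a ĝ is used twice, before and after φ is absorbed through φ
â = 𝓕(𝓕⁻¹φ * a). -/
theorem localize_restrictZ (φ : 𝓓(O, ℂ)) {a : RR d → ℂ} (ha : MemLp a 1 volume)
    (g : 𝓢(RR d, ℂ)) :
    localize φ (restrictZ O (Lp.toTemperedDistribution (ha.toLp a))) g =
      ∫ x, bandpass φ a x * g x := by
  have hai : Integrable a := memLp_one_iff_integrable.1 ha
  rw [localize_apply, hat_restrictZ, Lp.toTemperedDistribution_apply]
  have h1 : ∫ x, (𝓕 (toSchwartz (mulTest φ (𝓕⁻ g))) : 𝓢(RR d, ℂ)) x • ha.toLp a x =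
      ∫ x, a x * (𝓕 (toSchwartz (mulTest φ (𝓕⁻ g))) : 𝓢(RR d, ℂ)) x := by
    refine integral_congr_ae ?_
    filter_upwards [ha.coeFn_toLp] with x hx
    rw [hx, smul_eq_mul, mul_comm]
  rw [h1, ← integral_fourier_mul_schwartz hai]
  conv_rhs => rw [← FourierInvPair.fourier_fourierInv_eq (F := 𝓢(RR d, ℂ)) g]
  rw [← integral_fourier_mul_schwartz (integrable_bandpass φ hai)]
  congr 1 with x
  rw [fourier_bandpass φ hai, toSchwartz_apply, mulTest_apply]
  ring

/-- Conjugation exchanges the kernels of 𝓕 and 𝓕⁻¹; this is how the sesquilinear pairing leads to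
band-pass filtered atoms. -/
theorem fourier_conjTest (χ : 𝓓(O, ℂ)) (x : RR d) :
    (𝓕 (toSchwartz (conjTest χ)) : 𝓢(RR d, ℂ)) x = starRingEnd ℂ (𝓕⁻ (χ : RR d → ℂ) x) := by
  rw [← fourier_test_eq, Real.fourier_eq, Real.fourierInv_eq, ← integral_conj]
  congr 1 with ξ
  rw [conjTest_apply, Circle.smul_def, Circle.smul_def, smul_eq_mul, smul_eq_mul, map_mul,
    AddChar.map_neg_eq_inv, Circle.coe_inv_eq_conj]

/-- Fourier inversion applies because 𝓕⁻¹ψ * a is continuous and integrable and its transform ψ â is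
a test function. -/
theorem fourierInv_mulSmooth (ψ : 𝓓(O, ℂ)) {a : RR d → ℂ} (ha : Integrable a)
    (hs : ContDiff ℝ ∞ (𝓕 a)) : 𝓕⁻ (mulSmooth ψ (𝓕 a) hs : RR d → ℂ) = bandpass ψ a := by
  have h : (mulSmooth ψ (𝓕 a) hs : RR d → ℂ) = 𝓕 (bandpass ψ a) := by
    ext ξ
    rw [fourier_bandpass ψ ha, mulSmooth_apply]
  rw [h]
  refine Continuous.fourierInv_fourier_eq (continuous_bandpass ψ ha) (integrable_bandpass ψ ha) ?_
  rw [← h]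
  exact (toSchwartz (mulSmooth ψ (𝓕 a) hs)).integrable

theorem fourier_conjTest_mulSmooth (ψ : 𝓓(O, ℂ)) {a : RR d → ℂ} (ha : Integrable a)
    (hs : ContDiff ℝ ∞ (𝓕 a)) (x : RR d) :
    (𝓕 (toSchwartz (conjTest (mulSmooth ψ (𝓕 a) hs))) : 𝓢(RR d, ℂ)) x = starRingEnd ℂ (bandpass ψ a x) := by
  rw [fourier_conjTest, fourierInv_mulSmooth ψ ha]

theorem fourier_fourierInv_test (χ : 𝓓(O, ℂ)) : 𝓕 (𝓕⁻ (χ : RR d → ℂ)) = χ := by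
  rw [fourierInv_test_eq, ← SchwartzMap.fourier_coe, FourierInvPair.fourier_fourierInv_eq]
  rfl

/-- The Fourier transform of the conjugated product of two test functions. -/
theorem fourier_conjTest_mulTest (ψ χ : 𝓓(O, ℂ)) (x : RR d) :
    (𝓕 (toSchwartz (conjTest (mulTest ψ (toSchwartz χ)))) : 𝓢(RR d, ℂ)) x =
      starRingEnd ℂ (bandpass ψ (𝓕⁻ (χ : RR d → ℂ)) x) := by
  have hs : ContDiff ℝ ∞ (𝓕 (𝓕⁻ (χ : RR d → ℂ))) := by
    rw [fourier_fourierInv_test]; exact χ.contDiff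
  have : mulTest ψ (toSchwartz χ) = mulSmooth ψ (𝓕 (𝓕⁻ (χ : RR d → ℂ))) hs := by
    ext ξ
    rw [mulTest_apply, mulSmooth_apply, fourier_fourierInv_test]
    rfl
  rw [this, fourier_conjTest_mulSmooth ψ (integrable_fourierInv_test χ)]

theorem sum_test_apply {ι : Type*} (χ : ι → 𝓓(O, ℂ)) (s : Finset ι) (ξ : RR d) :
    (∑ i ∈ s, χ i) ξ = ∑ i ∈ s, χ i ξ := by
  induction s using Finset.cons_induction with
  | empty => rfl
  | cons a s ha ih => rw [Finset.sum_cons, Finset.sum_cons, add_apply, ih]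

/-- A test function is decomposed by a finite partition of unity on its support. -/
theorem hat_eq_sum {ι : Type*} (φ : ι → 𝓓(O, ℂ)) (s : Finset ι) (χ : 𝓓(O, ℂ))
    (h : ∀ ξ, χ ξ ≠ 0 → ∑ i ∈ s, φ i ξ = 1) (f : FourierDist O) :
    FourierDist.hat f χ = ∑ i ∈ s, localize (φ i) f (𝓕 (toSchwartz χ)) := by
  have : χ = ∑ i ∈ s, mulTest (φ i) (toSchwartz χ) := by
    ext ξ
    have h1 : (∑ i ∈ s, mulTest (φ i) (toSchwartz χ)) ξ = ∑ i ∈ s, φ i ξ * χ ξ := sum_test_apply ..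
    rw [h1, ← Finset.sum_mul]
    by_cases hξ : χ ξ = 0
    · rw [hξ, mul_zero]
    · rw [h ξ hξ, one_mul]
  conv_lhs => rw [this]
  rw [map_sum]
  simp_rw [hat_mulTest]

end GSIFrame

/-! ### Absolute convergence and majorants of the localized synthesis series -/

namespace GSIFrame

/-- Schur's test against a one-point space, with row integral ‖g‖_{L^1} and column bound sup |g|.
The constant depends on g and p but not on F, which later gives bounds uniform over translates. -/
theorem exists_lintegral_mul_schwartz_le {d : ℕ} {p : ℝ≥0∞} (hp : 1 ≤ p) (g : 𝓢(RR d, ℂ)) :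
    ∃ C : ℝ≥0∞, C < ⊤ ∧ ∀ F : RR d → ℝ≥0∞, AEMeasurable F →
      ∫⁻ x, F x * ‖g x‖ₑ ≤ C * eLpNorm F p volume := by
  have hg : ∫⁻ x, ‖g x‖ₑ < ⊤ := g.integrable.2
  let S := ENNReal.ofReal (SchwartzMap.seminorm ℂ 0 0 g)
  have hS : ∀ x, ‖g x‖ₑ ≤ S := fun x => by
    rw [← ofReal_norm]
    exact ENNReal.ofReal_le_ofReal (SchwartzMap.norm_le_seminorm ℂ g x)
  have hgm : AEMeasurable fun x => ‖g x‖ₑ := g.continuous.measurable.enorm.aemeasurable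
  have hi := toReal_inv_mem hp
  refine ⟨(∫⁻ x, ‖g x‖ₑ) ^ (1 - (p⁻¹).toReal) * S ^ (p⁻¹).toReal, ENNReal.mul_lt_top
    (ENNReal.rpow_lt_top_of_nonneg (by linarith) hg.ne)
    (ENNReal.rpow_lt_top_of_nonneg hi.1 ENNReal.ofReal_ne_top), fun F hF => ?_⟩
  have := eLpNorm_kernel_le (μ := (Measure.dirac () : Measure Unit)) (ν := (volume : Measure (RR d)))
    (fun _ x => ‖g x‖ₑ) (fun _ => hgm) (∫⁻ x, ‖g x‖ₑ) S hg.ne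
    (Eventually.of_forall fun _ => le_rfl) (Eventually.of_forall fun x => by simpa using hS x)
    (fun b _ => by simp) F hF p hp
  rw [eLpNorm_const _ (zero_lt_one.trans_le hp).ne' (NeZero.ne _)] at this
  simpa [mul_comm] using this

/-- A nonnegative function with finite `L^p` norm is integrable against Schwartz functions. -/
theorem lintegral_mul_schwartz_lt_top {d : ℕ} {F : RR d → ℝ≥0∞} (hF : AEMeasurable F) {p : ℝ≥0∞}
    (hp : 1 ≤ p) (hFp : eLpNorm F p volume < ⊤) (g : 𝓢(RR d, ℂ)) :
    ∫⁻ x, F x * ‖g x‖ₑ < ⊤ := by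
  obtain ⟨C, hC, h⟩ := exists_lintegral_mul_schwartz_le hp g
  exact (h F hF).trans_lt (ENNReal.mul_lt_top hC hFp)

variable {d : ℕ} {I J : Type*} {O : Opens (RR d)} {Q : I → Set (RR d)} {φ : I → 𝓓(O, ℂ)}

theorem fourierZ_surjective (η : FourierTest O) : ∃ χ, fourierZ O χ = η :=
  LinearMap.surjective_rangeRestrict _ η

/-- A linear functional on `Z(O)` whose localizations are tempered distributions is continuous. -/
theorem continuous_of_localized (hQ : IsAdmissibleCover O Q) (hφ : IsBAPU Q φ)
    (L : FourierTest O →ₗ[ℂ] ℂ) (T : I → 𝓢'(RR d, ℂ))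
    (h : ∀ (s : Finset I) (χ : 𝓓(O, ℂ)), (∀ ξ, χ ξ ≠ 0 → ∑ i ∈ s, φ i ξ = 1) →
      L (fourierZ O χ) = ∑ i ∈ s, T i (𝓕 (toSchwartz χ))) : Continuous L := by
  refine continuous_coinduced_dom.2 ?_
  change Continuous (L ∘ₗ (fourierZ O).toLinearMap)
  rw [TestFunction.continuous_iff_continuous_comp]
  intro K hK
  -- Continuity is tested on each compact K; there one finite index set serves all test functions,
  -- and the functional is a finite sum of tempered ones.
  obtain ⟨s, hs⟩ := hφ.exists_finset hQ K.isCompact hK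
  have hcont : Continuous fun χ : 𝓓_{K}(RR d, ℂ) =>
      ∑ i ∈ s, T i (𝓕 (toSchwartz (TestFunction.ofSupportedIn hK χ))) := by
    refine continuous_finsetSum _ fun i _ => ?_
    exact (T i).continuous.comp ((fourierTest O).continuous.comp
      (TestFunction.continuous_ofSupportedIn hK))
  refine hcont.congr fun χ => (h s _ fun ξ hξ => ?_).symm
  have hξK : ξ ∈ K := by
    by_contra hn
    exact hξ (χ.zero_on_compl hn)
  exact hφ.sum_eq_one s (hK hξK) fun i hi => hs i hi ξ hξK

theorem exists_partition_finset (hQ : IsAdmissibleCover O Q) (hφ : IsBAPU Q φ) (χ : 𝓓(O, ℂ)) :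
    ∃ s : Finset I, ∀ ξ, χ ξ ≠ 0 → ∑ i ∈ s, φ i ξ = 1 := by
  obtain ⟨s, hs⟩ := hφ.exists_finset hQ χ.hasCompactSupport χ.tsupport_subset
  exact ⟨s, fun ξ hξ => hφ.sum_eq_one s (χ.tsupport_subset (subset_tsupport _ hξ))
    fun i hi => hs i hi ξ (subset_tsupport _ hξ)⟩

namespace GSISystem

variable (G : GSISystem d J)

theorem integrable_g (j : J) : Integrable (G.g j) := memLp_one_iff_integrable.1 (G.memLp_one j)

theorem integrable_atom (j : J) (k : Fin d → ℤ) : Integrable (G.atom j k) :=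
  memLp_one_iff_integrable.1 (G.memLp_atom j k)

/-- The Wiener amalgam norm of the generator `j`, localized by `φ_i` and normalized by the lattice
matrix. -/
noncomputable def amalgam (φ : I → 𝓓(O, ℂ)) (i : I) (j : J) : ℝ≥0∞ :=
  amalgamNorm fun x => bandpass (φ i) (G.g j) (Matrix.toEuclideanLin (G.C j).1 x)

theorem schurMatrix_eq (φ : I → 𝓓(O, ℂ)) (w : I → ℝ) (v : J → ℝ) (i : I) (j : J) :
    G.schurMatrix φ w v i j = ENNReal.ofReal (max (w i / v j) (v j / w i) *
      |(G.C j).1.det| ^ (1 / 2 : ℝ)) * G.amalgam φ i j := rfl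

theorem bandpass_atom (φ : 𝓓(O, ℂ)) (j : J) (k : Fin d → ℤ) (x : RR d) :
    bandpass φ (G.atom j k) x =
      bandpass φ (G.g j) (x - Matrix.toEuclideanLin (G.C j).1 (intPoint k)) := by
  rw [atom, bandpass_translate]
  rfl

variable {w : I → ℝ} {v : J → ℝ}

theorem schurMatrix_le (φ : I → 𝓓(O, ℂ)) (i : I) (j : J) :
    G.schurMatrix φ w v i j ≤ schurNorm (G.schurMatrix φ w v) :=
  (ENNReal.le_tsum j).trans
    ((le_iSup (fun i => ∑' j, G.schurMatrix φ w v i j) i).trans (le_max_left _ _))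

theorem amalgam_ne_top (hG : G.IsAdapted φ w v) (hw : ∀ i, 0 < w i) (hv : ∀ j, 0 < v j) (i : I)
    (j : J) : G.amalgam φ i j ≠ ⊤ := by
  intro h
  have h1 := (G.schurMatrix_le (w := w) (v := v) φ i j).trans_lt hG
  rw [schurMatrix_eq, h, ENNReal.mul_top] at h1
  · exact h1.ne rfl
  · have := abs_det_pos (G.C j)
    have := hw i
    have := hv j
    simp only [ne_eq, ENNReal.ofReal_eq_zero, not_le]
    positivity

/-- Uses the entry w_i / v_j of the maximum. For r = 1/p, the left side carries the cost of lattice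
synthesis, and the right side the weight of Y_v^{p,q}. -/
theorem weight_mul_amalgam_le (hw : ∀ i, 0 < w i) (hv : ∀ j, 0 < v j) (i : I) (j : J) (r : ℝ) :
    ENNReal.ofReal (w i) * (ENNReal.ofReal (|(G.C j).1.det| ^ r) * G.amalgam φ i j) ≤
      G.schurMatrix φ w v i j * ENNReal.ofReal (v j * |(G.C j).1.det| ^ (r - 1 / 2)) := by
  have hd := abs_det_pos (G.C j)
  have hwi := hw i
  have hvj := hv j
  rw [schurMatrix_eq, mul_right_comm, ← mul_assoc, ← ENNReal.ofReal_mul hwi.le,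
    ← ENNReal.ofReal_mul (by positivity)]
  refine mul_le_mul_left (ENNReal.ofReal_le_ofReal ?_) _
  calc w i * |(G.C j).1.det| ^ r
      = w i / v j * |(G.C j).1.det| ^ (1 / 2 : ℝ) * (v j * |(G.C j).1.det| ^ (r - 1 / 2)) := by
        rw [Real.rpow_sub hd]
        field_simp
    _ ≤ _ := by
        gcongr
        exact le_max_left _ _

/-- The counterpart for correlation, whose cost is |det C_j|^{1-r}; it uses the entry v_j / w_i of
the maximum. -/
theorem coeffWeight_mul_amalgam_le (hw : ∀ i, 0 < w i) (hv : ∀ j, 0 < v j) (i : I) (j : J)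
    (r : ℝ) : ENNReal.ofReal (v j * |(G.C j).1.det| ^ (r - 1 / 2)) *
      (ENNReal.ofReal (|(G.C j).1.det| ^ (1 - r)) * G.amalgam φ i j) ≤
      G.schurMatrix φ w v i j * ENNReal.ofReal (w i) := by
  have hd := abs_det_pos (G.C j)
  have hwi := hw i
  have hvj := hv j
  rw [schurMatrix_eq, mul_right_comm, ← mul_assoc, ← ENNReal.ofReal_mul (by positivity),
    ← ENNReal.ofReal_mul (by positivity)]
  refine mul_le_mul_left (ENNReal.ofReal_le_ofReal ?_) _
  calc v j * |(G.C j).1.det| ^ (r - 1 / 2) * |(G.C j).1.det| ^ (1 - r)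
      = v j / w i * |(G.C j).1.det| ^ (1 / 2 : ℝ) * w i := by
        rw [mul_assoc, ← Real.rpow_add hd]
        field_simp
        congr 1
        ring
    _ ≤ _ := by
        gcongr
        exact le_max_right _ _

/-- The pointwise majorant of the localized synthesis series. -/
noncomputable def majorant (φ : I → 𝓓(O, ℂ)) (a : J → (Fin d → ℤ) → ℝ≥0∞) (i : I) (x : RR d) :
    ℝ≥0∞ := ∑' j, ∑' k, a j k * ‖bandpass (φ i) (G.atom j k) x‖ₑ

theorem measurable_bandpass_atom (φ : 𝓓(O, ℂ)) (j : J) (k : Fin d → ℤ) :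
    Measurable (bandpass φ (G.atom j k)) :=
  (continuous_bandpass φ (G.integrable_atom j k)).measurable

theorem measurable_majorant [Countable J] (a : J → (Fin d → ℤ) → ℝ≥0∞) (i : I) :
    Measurable (G.majorant φ a i) :=
  Measurable.tsum fun j => Measurable.tsum fun k =>
    (G.measurable_bandpass_atom (φ i) j k).enorm.const_mul (a j k)

theorem majorant_eq (a : J → (Fin d → ℤ) → ℝ≥0∞) (i : I) (x : RR d) :
    G.majorant φ a i x =
      ∑' jk : J × (Fin d → ℤ), a jk.1 jk.2 * ‖bandpass (φ i) (G.atom jk.1 jk.2) x‖ₑ :=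
  (ENNReal.tsum_prod' (f := fun jk : J × (Fin d → ℤ) =>
    a jk.1 jk.2 * ‖bandpass (φ i) (G.atom jk.1 jk.2) x‖ₑ)).symm

theorem measurable_bandpass_mul (φ : 𝓓(O, ℂ)) (j : J) (k : Fin d → ℤ) (g : 𝓢(RR d, ℂ)) :
    Measurable fun x => bandpass φ (G.atom j k) x * g x :=
  (G.measurable_bandpass_atom φ j k).mul g.continuous.measurable

/-- The norm of a nonnegative coefficient family in `Y_v^{p,q}`. -/
noncomputable def enormCoeff (v : J → ℝ) (p q : ℝ≥0∞) (a : J → (Fin d → ℤ) → ℝ≥0∞) : ℝ≥0∞ :=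
  wlqNorm q (fun j => v j * |(G.C j).1.det| ^ ((p⁻¹).toReal - 1 / 2)) fun j => lqNorm p (a j)

/-- Minkowski over j and the lattice synthesis bound for each j leave a matrix acting on the
sequence whose ℓ^q norm is the norm of Y_v^{p,q}. -/
theorem weight_mul_eLpNorm_majorant_le [Countable J] (hG : G.IsAdapted φ w v) (hw : ∀ i, 0 < w i)
    (hv : ∀ j, 0 < v j) (p : ℝ≥0∞) (hp : 1 ≤ p) (a : J → (Fin d → ℤ) → ℝ≥0∞) (i : I) :
    ENNReal.ofReal (w i) * eLpNorm (G.majorant φ a i) p volume ≤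
      ∑' j, G.schurMatrix φ w v i j *
        (ENNReal.ofReal (v j * |(G.C j).1.det| ^ ((p⁻¹).toReal - 1 / 2)) * lqNorm p (a j)) := by
  have h1 : eLpNorm (G.majorant φ a i) p volume ≤ ∑' j,
      ENNReal.ofReal (|(G.C j).1.det| ^ (p⁻¹).toReal) * G.amalgam φ i j * lqNorm p (a j) := by
    refine (eLpNorm_tsum_le _ (fun j => (Measurable.tsum fun k =>
      (G.measurable_bandpass_atom (φ i) j k).enorm.const_mul (a j k)).aemeasurable) p hp).trans
      (ENNReal.tsum_le_tsum fun j => ?_)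
    simp_rw [bandpass_atom]
    exact eLpNorm_tsum_lattice_le (G.C j) _
      (continuous_bandpass (φ i) (G.integrable_g j)).aestronglyMeasurable
      (G.amalgam_ne_top hG hw hv i j) (a j) p hp
  refine (mul_le_mul_right h1 _).trans ?_
  rw [← ENNReal.tsum_mul_left]
  refine ENNReal.tsum_le_tsum fun j => ?_
  rw [← mul_assoc, ← mul_assoc (G.schurMatrix φ w v i j)]
  gcongr ?_ * _
  exact G.weight_mul_amalgam_le hw hv i j _

theorem wlqNorm_majorant_le [Countable I] [Countable J] (hG : G.IsAdapted φ w v)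
    (hw : ∀ i, 0 < w i) (hv : ∀ j, 0 < v j) (p q : ℝ≥0∞) (hp : 1 ≤ p) (hq : 1 ≤ q)
    (a : J → (Fin d → ℤ) → ℝ≥0∞) :
    wlqNorm q w (fun i => eLpNorm (G.majorant φ a i) p volume) ≤
      schurNorm (G.schurMatrix φ w v) * G.enormCoeff v p q a :=
  (lqNorm_mono q fun i => G.weight_mul_eLpNorm_majorant_le hG hw hv p hp a i).trans
    (lqNorm_matrix_le _ hG _ q hq)

theorem eLpNorm_majorant_lt_top [Countable I] [Countable J] (hG : G.IsAdapted φ w v)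
    (hw : ∀ i, 0 < w i) (hv : ∀ j, 0 < v j) (p q : ℝ≥0∞) (hp : 1 ≤ p) (hq : 1 ≤ q)
    (a : J → (Fin d → ℤ) → ℝ≥0∞) (ha : G.enormCoeff v p q a < ⊤) (i : I) :
    eLpNorm (G.majorant φ a i) p volume < ⊤ := by
  have h1 := (le_lqNorm q hq (fun i => ENNReal.ofReal (w i) *
    eLpNorm (G.majorant φ a i) p volume) i).trans_lt
    ((G.wlqNorm_majorant_le hG hw hv p q hp hq a).trans_lt (ENNReal.mul_lt_top hG ha))
  exact ENNReal.lt_top_of_mul_ne_top_right h1.ne (by simpa using hw i)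

/-- Justifies exchanging the sum over (j, k) with integration against g: by Tonelli the quantity
equals the integral of the majorant times |g|. -/
theorem tsum_lintegral_lt_top [Countable I] [Countable J] (hG : G.IsAdapted φ w v)
    (hw : ∀ i, 0 < w i) (hv : ∀ j, 0 < v j) (p q : ℝ≥0∞) (hp : 1 ≤ p) (hq : 1 ≤ q)
    (a : J → (Fin d → ℤ) → ℝ≥0∞) (ha : G.enormCoeff v p q a < ⊤) (i : I) (g : 𝓢(RR d, ℂ)) :
    ∑' jk : J × (Fin d → ℤ), ∫⁻ x, a jk.1 jk.2 *
      ‖bandpass (φ i) (G.atom jk.1 jk.2) x * g x‖ₑ < ⊤ := by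
  have hm : ∀ jk : J × (Fin d → ℤ), AEMeasurable fun x => a jk.1 jk.2 *
      ‖bandpass (φ i) (G.atom jk.1 jk.2) x * g x‖ₑ := fun jk =>
    ((G.measurable_bandpass_mul (φ i) jk.1 jk.2 g).enorm.const_mul (a jk.1 jk.2)).aemeasurable
  rw [← lintegral_tsum hm]
  refine lt_of_le_of_lt (le_of_eq ?_) (lintegral_mul_schwartz_lt_top
    (G.measurable_majorant a i).aemeasurable hp
    (G.eLpNorm_majorant_lt_top hG hw hv p q hp hq a ha i) g)
  congr 1 with x
  simp only [enorm_mul, ← mul_assoc]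
  rw [ENNReal.tsum_mul_right, majorant_eq]

/-- The localized atoms tested against a Schwartz function. -/
theorem localize_atomZ (φ : 𝓓(O, ℂ)) (j : J) (k : Fin d → ℤ) (g : 𝓢(RR d, ℂ)) :
    localize φ (G.atomZ O j k) g = ∫ x, bandpass φ (G.atom j k) x * g x :=
  localize_restrictZ φ (G.memLp_atom j k) g

theorem tsum_localize_atomZ_lt_top [Countable I] [Countable J] (hG : G.IsAdapted φ w v)
    (hw : ∀ i, 0 < w i) (hv : ∀ j, 0 < v j) (p q : ℝ≥0∞) (hp : 1 ≤ p) (hq : 1 ≤ q)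
    (a : J → (Fin d → ℤ) → ℝ≥0∞) (ha : G.enormCoeff v p q a < ⊤) (i : I) (g : 𝓢(RR d, ℂ)) :
    ∑' jk : J × (Fin d → ℤ), a jk.1 jk.2 * ‖localize (φ i) (G.atomZ O jk.1 jk.2) g‖ₑ < ⊤ := by
  refine lt_of_le_of_lt (ENNReal.tsum_le_tsum fun jk => ?_)
    (G.tsum_lintegral_lt_top hG hw hv p q hp hq a ha i g)
  rw [localize_atomZ, lintegral_const_mul _ (G.measurable_bandpass_mul (φ i) jk.1 jk.2 g).enorm]
  gcongr
  exact enorm_integral_le_lintegral_enorm _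

/-- The coefficients of the synthesis series, tested against an element of `Z(O)`, are absolutely
summable. -/
theorem tsum_atomZ_lt_top [Countable J] (hQ : IsAdmissibleCover O Q) (hφ : IsBAPU Q φ)
    (hG : G.IsAdapted φ w v)
    (hw : ∀ i, 0 < w i) (hv : ∀ j, 0 < v j) (p q : ℝ≥0∞) (hp : 1 ≤ p) (hq : 1 ≤ q)
    (a : J → (Fin d → ℤ) → ℝ≥0∞) (ha : G.enormCoeff v p q a < ⊤) (η : FourierTest O) :
    ∑' jk : J × (Fin d → ℤ), a jk.1 jk.2 * ‖G.atomZ O jk.1 jk.2 η‖ₑ < ⊤ := by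
  have : Countable I := hφ.countable hQ
  obtain ⟨χ, rfl⟩ := fourierZ_surjective η
  obtain ⟨s, hs⟩ := exists_partition_finset hQ hφ χ
  refine lt_of_le_of_lt (b := ∑ i ∈ s, ∑' jk : J × (Fin d → ℤ),
    a jk.1 jk.2 * ‖localize (φ i) (G.atomZ O jk.1 jk.2) (𝓕 (toSchwartz χ))‖ₑ) ?_ ?_
  · rw [← Summable.tsum_finsetSum fun _ _ => ENNReal.summable]
    refine ENNReal.tsum_le_tsum fun jk => ?_
    rw [← Finset.mul_sum]
    gcongr
    refine le_trans (le_of_eq ?_) (enorm_sum_le _ _)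
    congr 1
    exact hat_eq_sum φ s χ hs (G.atomZ O jk.1 jk.2)
  · exact ENNReal.sum_lt_top.2 fun i _ =>
      G.tsum_localize_atomZ_lt_top hG hw hv p q hp hq a ha i _

theorem summable_atomZ [Countable J] (hQ : IsAdmissibleCover O Q) (hφ : IsBAPU Q φ)
    (hG : G.IsAdapted φ w v)
    (hw : ∀ i, 0 < w i) (hv : ∀ j, 0 < v j) (p q : ℝ≥0∞) (hp : 1 ≤ p) (hq : 1 ≤ q)
    (c : J → (Fin d → ℤ) → ℂ) (hc : G.coeffNorm v p q c < ⊤) (η : FourierTest O) :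
    Summable fun jk : J × (Fin d → ℤ) => c jk.1 jk.2 * G.atomZ O jk.1 jk.2 η := by
  refine Summable.of_enorm ?_
  simp only [enorm_mul]
  exact (G.tsum_atomZ_lt_top hQ hφ hG hw hv p q hp hq _ hc η).ne

/-- The function that represents the localization of a synthesis series. -/
noncomputable def synthFun (φ : I → 𝓓(O, ℂ)) (c : J → (Fin d → ℤ) → ℂ) (i : I) (x : RR d) : ℂ :=
  ∑' jk : J × (Fin d → ℤ), c jk.1 jk.2 * bandpass (φ i) (G.atom jk.1 jk.2) x

/-- No exceptional set is needed: where the series is not summable, its `tsum` is zero. -/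
theorem enorm_synthFun_le (c : J → (Fin d → ℤ) → ℂ) (i : I) (x : RR d) :
    ‖G.synthFun φ c i x‖ₑ ≤ G.majorant φ (fun j k => ‖c j k‖ₑ) i x := by
  refine enorm_tsum_le_tsum_enorm.trans_eq ?_
  simp only [majorant_eq, enorm_mul]

theorem ae_lt_top_of_eLpNorm_lt_top {F : RR d → ℝ≥0∞} (hF : AEMeasurable F) {p : ℝ≥0∞}
    (hp : 1 ≤ p) (h : eLpNorm F p volume < ⊤) : ∀ᵐ x, F x < ⊤ := by
  rcases eq_or_ne p ⊤ with rfl | hpt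
  · rw [eLpNorm_exponent_top] at h
    filter_upwards [enorm_ae_le_eLpNormEssSup F volume] with x hx
    exact lt_of_le_of_lt (by simpa using hx) h
  · have hp0 := (zero_lt_one.trans_le hp).ne'
    have hr := ENNReal.toReal_pos hp0 hpt
    have h1 := lintegral_rpow_enorm_lt_top_of_eLpNorm_lt_top hp0 hpt h
    filter_upwards [ae_lt_top' (by simpa using hF.pow_const _) h1.ne] with x hx
    simpa [ENNReal.rpow_lt_top_iff_of_pos hr] using hx

/-- A majorant of finite L^p norm is finite almost everywhere. There the series converges
absolutely, so its sum is an almost everywhere limit of measurable partial sums. -/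
theorem memLp_synthFun [Countable I] [Countable J] (hG : G.IsAdapted φ w v)
    (hw : ∀ i, 0 < w i) (hv : ∀ j, 0 < v j) (p q : ℝ≥0∞) (hp : 1 ≤ p) (hq : 1 ≤ q)
    (c : J → (Fin d → ℤ) → ℂ) (hc : G.coeffNorm v p q c < ⊤) (i : I) :
    MemLp (G.synthFun φ c i) p volume := by
  have hfin := G.eLpNorm_majorant_lt_top hG hw hv p q hp hq _ hc i
  have hae := ae_lt_top_of_eLpNorm_lt_top
    (G.measurable_majorant (φ := φ) (fun j k => ‖c j k‖ₑ) i).aemeasurable hp hfin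
  refine ⟨?_, ?_⟩
  · refine aestronglyMeasurable_of_tendsto_ae (atTop : Filter (Finset (J × (Fin d → ℤ))))
      (f := fun s x => ∑ jk ∈ s, c jk.1 jk.2 * bandpass (φ i) (G.atom jk.1 jk.2) x) ?_ ?_
    · intro s
      exact (Finset.measurable_fun_sum s fun jk _ =>
        (G.measurable_bandpass_atom (φ i) jk.1 jk.2).const_mul _).aestronglyMeasurable
    · filter_upwards [hae] with x hx
      refine Summable.hasSum (Summable.of_enorm ?_)
      rw [majorant_eq] at hx
      simpa only [enorm_mul] using hx.ne
  · refine lt_of_le_of_lt (eLpNorm_mono_enorm fun x => ?_) hfin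
    simpa using G.enorm_synthFun_le c i x

theorem hasSum_localize_atomZ [Countable I] [Countable J] (hG : G.IsAdapted φ w v)
    (hw : ∀ i, 0 < w i) (hv : ∀ j, 0 < v j) (p q : ℝ≥0∞) (hp : 1 ≤ p) (hq : 1 ≤ q)
    (c : J → (Fin d → ℤ) → ℂ) (hc : G.coeffNorm v p q c < ⊤) (i : I) (g : 𝓢(RR d, ℂ)) :
    HasSum (fun jk : J × (Fin d → ℤ) => c jk.1 jk.2 * localize (φ i) (G.atomZ O jk.1 jk.2) g)
      (∫ x, G.synthFun φ c i x * g x) := by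
  have hm : ∀ jk : J × (Fin d → ℤ), AEStronglyMeasurable
      fun x => c jk.1 jk.2 * (bandpass (φ i) (G.atom jk.1 jk.2) x * g x) := fun jk =>
    ((G.measurable_bandpass_mul (φ i) jk.1 jk.2 g).const_mul _).aestronglyMeasurable
  have h := G.tsum_lintegral_lt_top hG hw hv p q hp hq _ hc i g
  have h2 : ∑' jk : J × (Fin d → ℤ), ∫⁻ x, ‖c jk.1 jk.2 *
      (bandpass (φ i) (G.atom jk.1 jk.2) x * g x)‖ₑ ≠ ⊤ := by
    simpa only [enorm_mul] using h.ne
  have h3 := integral_tsum hm h2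
  have h4 : Summable fun jk : J × (Fin d → ℤ) =>
      c jk.1 jk.2 * localize (φ i) (G.atomZ O jk.1 jk.2) g := by
    refine Summable.of_enorm ?_
    simp only [enorm_mul]
    exact (G.tsum_localize_atomZ_lt_top hG hw hv p q hp hq _ hc i g).ne
  convert h4.hasSum using 1
  simp_rw [localize_atomZ, ← integral_const_mul]
  rw [← h3]
  congr 1 with x
  simp_rw [← mul_assoc]
  rw [tsum_mul_right]
  rfl

end GSISystem

end GSIFrame

/-! ### The synthesis operator -/

namespace GSIFrame

variable {d : ℕ} {I J : Type*} {O : Opens (RR d)} {Q : I → Set (RR d)} {φ : I → 𝓓(O, ℂ)}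

theorem hasSum_iff_forall {ι : Type*} (f : ι → FourierDist O) (f₀ : FourierDist O) :
    HasSum f f₀ ↔ ∀ η, HasSum (fun i => f i η) (f₀ η) := by
  unfold HasSum
  rw [PointwiseConvergenceCLM.tendsto_iff_forall_tendsto]
  have h : ∀ (s : Finset ι) (η : FourierTest O), (∑ i ∈ s, f i) η = ∑ i ∈ s, f i η := by
    intro s η
    exact map_sum (PointwiseConvergenceCLM.evalCLM (RingHom.id ℂ) ℂ η) f s
  simp_rw [h]

theorem temperedLpNorm_le (p : ℝ≥0∞) [Fact (1 ≤ p)] (T : 𝓢'(RR d, ℂ)) {h : RR d → ℂ}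
    (hh : MemLp h p volume) (hT : ∀ g : 𝓢(RR d, ℂ), T g = ∫ x, h x * g x) :
    temperedLpNorm p T ≤ eLpNorm h p volume := by
  refine (iInf₂_le (hh.toLp h) ?_).trans_eq (Lp.enorm_toLp hh)
  ext g
  rw [Lp.toTemperedDistribution_apply, hT]
  refine integral_congr_ae ?_
  filter_upwards [hh.coeFn_toLp] with x hx
  rw [hx, smul_eq_mul, mul_comm]

namespace GSISystem

variable (G : GSISystem d J) {w : I → ℝ} {v : J → ℝ}

/-- The synthesis functional on `Z(O)`, as a linear map. -/
noncomputable def synthLinear (c : J → (Fin d → ℤ) → ℂ)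
    (hc : ∀ η : FourierTest O,
      Summable fun jk : J × (Fin d → ℤ) => c jk.1 jk.2 * G.atomZ O jk.1 jk.2 η) :
    FourierTest O →ₗ[ℂ] ℂ where
  toFun η := ∑' jk : J × (Fin d → ℤ), c jk.1 jk.2 * G.atomZ O jk.1 jk.2 η
  map_add' η ζ := by
    rw [← (hc η).tsum_add (hc ζ)]
    simp_rw [map_add, mul_add]
  map_smul' r η := by
    rw [RingHom.id_apply, smul_eq_mul, ← tsum_mul_left]
    simp_rw [map_smul, smul_eq_mul, mul_left_comm]

variable [Countable J]

/-- The sum is defined only pointwise on Z(O). Its localizations are given by the L^p functions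
`synthFun`, hence are tempered, and `continuous_of_localized` glues them. -/
theorem continuous_synthLinear (hQ : IsAdmissibleCover O Q) (hφ : IsBAPU Q φ)
    (hG : G.IsAdapted φ w v) (hw : ∀ i, 0 < w i) (hv : ∀ j, 0 < v j) (p q : ℝ≥0∞)
    [hp : Fact (1 ≤ p)] (hq : 1 ≤ q) (c : J → (Fin d → ℤ) → ℂ) (hc : G.coeffNorm v p q c < ⊤)
    (hs : ∀ η : FourierTest O,
      Summable fun jk : J × (Fin d → ℤ) => c jk.1 jk.2 * G.atomZ O jk.1 jk.2 η) :
    Continuous (G.synthLinear c hs) := by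
  have : Countable I := hφ.countable hQ
  refine continuous_of_localized hQ hφ _ (fun i => Lp.toTemperedDistribution
    ((G.memLp_synthFun hG hw hv p q hp.out hq c hc i).toLp (G.synthFun φ c i))) fun s χ hχ => ?_
  change ∑' jk : J × (Fin d → ℤ), c jk.1 jk.2 * G.atomZ O jk.1 jk.2 (fourierZ O χ) = _
  refine HasSum.tsum_eq ?_
  have h1 : ∀ jk : J × (Fin d → ℤ), c jk.1 jk.2 * G.atomZ O jk.1 jk.2 (fourierZ O χ) =
      ∑ i ∈ s, c jk.1 jk.2 * localize (φ i) (G.atomZ O jk.1 jk.2) (𝓕 (toSchwartz χ)) := by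
    intro jk
    rw [← Finset.mul_sum, ← hat_eq_sum φ s χ hχ]
    rfl
  simp_rw [h1]
  refine hasSum_sum fun i _ => ?_
  convert G.hasSum_localize_atomZ hG hw hv p q hp.out hq c hc i (𝓕 (toSchwartz χ)) using 1
  rw [Lp.toTemperedDistribution_apply]
  refine integral_congr_ae ?_
  filter_upwards [(G.memLp_synthFun hG hw hv p q hp.out hq c hc i).coeFn_toLp] with x hx
  rw [hx, smul_eq_mul, mul_comm]

/-- The bounded synthesis operator. -/
theorem exists_synthesis (hQ : IsAdmissibleCover O Q) (hφ : IsBAPU Q φ)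
    (hG : G.IsAdapted φ w v) (hw : ∀ i, 0 < w i) (hv : ∀ j, 0 < v j) (p q : ℝ≥0∞)
    [hp : Fact (1 ≤ p)] [hq : Fact (1 ≤ q)] :
    ∃ D : G.CoeffSpace v p q →ₗ[ℂ] DecompSpace φ w p q,
      ∀ c : G.CoeffSpace v p q,
        HasSum (fun jk : J × (Fin d → ℤ) => c.1 jk.1 jk.2 • G.atomZ O jk.1 jk.2)
          (D c : FourierDist O) ∧
        decompNorm φ w p q (D c) ≤ schurNorm (G.schurMatrix φ w v) * G.coeffNorm v p q c := by
  have : Countable I := hφ.countable hQ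
  have hs := fun c : G.CoeffSpace v p q =>
    G.summable_atomZ hQ hφ hG hw hv p q hp.out hq.out c.1 c.2
  let D₀ : G.CoeffSpace v p q → FourierDist O := fun c =>
    ⟨G.synthLinear c.1 (hs c), G.continuous_synthLinear hQ hφ hG hw hv p q hq.out c.1 c.2 (hs c)⟩
  have hsum : ∀ c : G.CoeffSpace v p q,
      HasSum (fun jk : J × (Fin d → ℤ) => c.1 jk.1 jk.2 • G.atomZ O jk.1 jk.2) (D₀ c) := by
    intro c
    rw [hasSum_iff_forall]
    exact fun η => (hs c η).hasSum
  have hnorm : ∀ c : G.CoeffSpace v p q, decompNorm φ w p q (D₀ c) ≤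
      schurNorm (G.schurMatrix φ w v) * G.coeffNorm v p q c := by
    intro c
    refine (wlqNorm_mono q w fun i => ?_).trans
      (G.wlqNorm_majorant_le hG hw hv p q hp.out hq.out _)
    refine (temperedLpNorm_le p _
      (G.memLp_synthFun hG hw hv p q hp.out hq.out c.1 c.2 i) fun g => ?_).trans ?_
    · refine HasSum.unique ?_ (G.hasSum_localize_atomZ hG hw hv p q hp.out hq.out c.1 c.2 i g)
      exact (hasSum_iff_forall _ _).1 (hsum c) _
    · refine eLpNorm_mono_enorm fun x => ?_
      simpa using G.enorm_synthFun_le c.1 i x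
  have hmem : ∀ c, D₀ c ∈ DecompSpace φ w p q := fun c =>
    (hnorm c).trans_lt (ENNReal.mul_lt_top hG c.2)
  refine ⟨{ toFun := fun c => ⟨D₀ c, hmem c⟩, map_add' := ?_, map_smul' := ?_ },
    fun c => ⟨hsum c, hnorm c⟩⟩
  · intro b c
    -- Linearity comes from uniqueness of sums in the weak-star topology.
    refine Subtype.ext (HasSum.unique (hsum (b + c)) ?_)
    convert (hsum b).add (hsum c) using 1
    · refine funext fun jk => ContinuousLinearMap.ext fun η => ?_
      exact add_mul (b.1 jk.1 jk.2) (c.1 jk.1 jk.2) (G.atomZ O jk.1 jk.2 η)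
    · rfl
  · intro r c
    refine Subtype.ext (HasSum.unique (hsum (r • c)) ?_)
    convert (hsum c).const_smul r using 1
    · exact funext fun jk => mul_smul r (c.1 jk.1 jk.2) _
    · rfl

/-- Dominated convergence for synthesis series. -/
theorem tendsto_synthesis (hQ : IsAdmissibleCover O Q) (hφ : IsBAPU Q φ)
    (hG : G.IsAdapted φ w v) (hw : ∀ i, 0 < w i) (hv : ∀ j, 0 < v j) (p q : ℝ≥0∞)
    (hp : 1 ≤ p) (hq : 1 ≤ q) (a : J → (Fin d → ℤ) → ℝ≥0∞) (ha : G.enormCoeff v p q a < ⊤)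
    (c : ℕ → J → (Fin d → ℤ) → ℂ) (c₀ : J → (Fin d → ℤ) → ℂ)
    (hc : ∀ n j k, ‖c n j k‖ₑ ≤ a j k)
    (hlim : ∀ j k, Tendsto (fun n => c n j k) atTop (𝓝 (c₀ j k)))
    (f : ℕ → FourierDist O) (f₀ : FourierDist O)
    (hf : ∀ n, HasSum (fun jk : J × (Fin d → ℤ) => c n jk.1 jk.2 • G.atomZ O jk.1 jk.2) (f n))
    (hf₀ : HasSum (fun jk : J × (Fin d → ℤ) => c₀ jk.1 jk.2 • G.atomZ O jk.1 jk.2) f₀) :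
    Tendsto f atTop (𝓝 f₀) := by
  rw [PointwiseConvergenceCLM.tendsto_iff_forall_tendsto]
  intro η
  have h1 : ∀ n, f n η = ∑' jk : J × (Fin d → ℤ), c n jk.1 jk.2 * G.atomZ O jk.1 jk.2 η :=
    fun n => ((hasSum_iff_forall _ _).1 (hf n) η).tsum_eq.symm
  have h2 : f₀ η = ∑' jk : J × (Fin d → ℤ), c₀ jk.1 jk.2 * G.atomZ O jk.1 jk.2 η :=
    ((hasSum_iff_forall _ _).1 hf₀ η).tsum_eq.symm
  simp only [h1, h2]
  have hfin := (G.tsum_atomZ_lt_top hQ hφ hG hw hv p q hp hq a ha η).ne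
  -- The dominating family is a_{jk} times the modulus of the atom evaluated at η, independent of n.
  refine tendsto_tsum_of_dominated_convergence (ENNReal.summable_toReal hfin)
    (fun jk => (hlim jk.1 jk.2).mul_const _) (Eventually.of_forall fun n jk => ?_)
  rw [← toReal_enorm]
  refine ENNReal.toReal_mono (ENNReal.ne_top_of_tsum_ne_top hfin jk) ?_
  rw [enorm_mul]
  gcongr
  exact hc n jk.1 jk.2

end GSISystem

end GSIFrame

/-! ### The coefficient operator -/

namespace GSIFrame

variable {d : ℕ} {I J : Type*} {O : Opens (RR d)} {Q : I → Set (RR d)} {φ ψ : I → 𝓓(O, ℂ)}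

/-- The localizations of `f` are dominated by the family `F`, as functionals. -/
def IsLocDominated (φ : I → 𝓓(O, ℂ)) (F : I → RR d → ℝ≥0∞) (f : FourierDist O) : Prop :=
  ∀ i (g : 𝓢(RR d, ℂ)), ‖localize (φ i) f g‖ₑ ≤ ∫⁻ x, F i x * ‖g x‖ₑ

theorem isLocDominated_of_integral {f : FourierDist O} {h : I → RR d → ℂ}
    (hf : ∀ i (g : 𝓢(RR d, ℂ)), localize (φ i) f g = ∫ x, h i x * g x) {F : I → RR d → ℝ≥0∞}
    (hF : ∀ i, ∀ᵐ x, ‖h i x‖ₑ ≤ F i x) : IsLocDominated φ F f := by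
  intro i g
  rw [hf]
  refine (enorm_integral_le_lintegral_enorm _).trans (lintegral_mono_ae ?_)
  filter_upwards [hF i] with x hx
  rw [enorm_mul]
  gcongr

/-- An L^p function is determined by its tempered distribution, so the infimum runs over a single
element and is attained. -/
theorem exists_lp_of_temperedLpNorm_lt_top {p : ℝ≥0∞} [Fact (1 ≤ p)] {T : 𝓢'(RR d, ℂ)}
    (hT : temperedLpNorm p T < ⊤) : ∃ h : Lp ℂ p (volume : Measure (RR d)),
      Lp.toTemperedDistribution h = T ∧ temperedLpNorm p T = ‖h‖ₑ := by
  simp only [temperedLpNorm, iInf_lt_iff] at hT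
  obtain ⟨h, hh, _⟩ := hT
  refine ⟨h, hh, le_antisymm (iInf₂_le h hh) (le_iInf₂ fun k hk => ?_)⟩
  have : h = k := by
    refine LinearMap.ker_eq_bot.1
      (Lp.ker_toTemperedDistributionCLM_eq_bot (F := ℂ) (μ := (volume : Measure (RR d)))) ?_
    exact hh.trans hk.symm
  rw [this]

/-- The elements of a decomposition space are dominated by a family in `ℓ^q_w(I; L^p)` of the same
norm. -/
theorem exists_isLocDominated {w : I → ℝ} (hw : ∀ i, 0 < w i) (p q : ℝ≥0∞) [Fact (1 ≤ p)]
    (hq : 1 ≤ q) (f : FourierDist O) (hf : decompNorm φ w p q f < ⊤) :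
    ∃ F : I → RR d → ℝ≥0∞, (∀ i, AEMeasurable (F i)) ∧ IsLocDominated φ F f ∧
      wlqNorm q w (fun i => eLpNorm (F i) p volume) = decompNorm φ w p q f := by
  have h1 : ∀ i, temperedLpNorm p (localize (φ i) f) < ⊤ := fun i =>
    ENNReal.lt_top_of_mul_ne_top_right ((le_lqNorm q hq (fun i => ENNReal.ofReal (w i) *
      temperedLpNorm p (localize (φ i) f)) i).trans_lt hf).ne (by simpa using hw i)
  choose h hh hn using fun i => exists_lp_of_temperedLpNorm_lt_top (h1 i)
  refine ⟨fun i x => ‖h i x‖ₑ, fun i => (Lp.aestronglyMeasurable (h i)).enorm, ?_, ?_⟩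
  · refine isLocDominated_of_integral (h := fun i => h i) (fun i g => ?_)
      fun i => Eventually.of_forall fun x => le_rfl
    rw [← hh i, Lp.toTemperedDistribution_apply]
    simp_rw [smul_eq_mul, mul_comm]
  · unfold decompNorm
    congr 1
    ext i
    rw [hn i, Lp.enorm_def, eLpNorm_enorm]

/-- Only domination of the localizations of f is used, so the bound serves single elements and
dominated sequences alike. -/
theorem enorm_hat_le {F : I → RR d → ℝ≥0∞} {f : FourierDist O} (hf : IsLocDominated φ F f)
    (s : Finset I) (χ : 𝓓(O, ℂ)) (hs : ∀ ξ, χ ξ ≠ 0 → ∑ i ∈ s, φ i ξ = 1) :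
    ‖FourierDist.hat f χ‖ₑ ≤ ∑ i ∈ s, ∫⁻ x, F i x * ‖(𝓕 (toSchwartz χ) : 𝓢(RR d, ℂ)) x‖ₑ := by
  rw [hat_eq_sum φ s χ hs]
  exact (enorm_sum_le _ _).trans (Finset.sum_le_sum fun i _ => hf i _)

theorem enorm_conj (z : ℂ) : ‖starRingEnd ℂ z‖ₑ = ‖z‖ₑ := by
  rw [← ofReal_norm, ← ofReal_norm, RCLike.norm_conj]

/-- The function lives where ψ_i ≠ 0, hence inside Q_i, where the φ_l with l ∈ i^* exhaust the
partition. The two partitions interact only through the common cover. -/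
theorem sum_eq_one_of_conjTest_mul (hQ : IsAdmissibleCover O Q) (hφ : IsBAPU Q φ)
    (hψ : IsBAPU Q ψ) (i : I) (χ : 𝓓(O, ℂ)) (hχ : ∀ ξ, ψ i ξ = 0 → χ ξ = 0) (ξ : RR d)
    (hξ : conjTest χ ξ ≠ 0) : ∑ l ∈ hQ.clusterFinset i, φ l ξ = 1 := by
  refine hφ.sum_cluster_eq_one hQ (hψ.mem_of_ne_zero fun h => hξ ?_)
  rw [conjTest_apply, hχ ξ h, map_zero]

theorem enorm_pairingTerm_le (hQ : IsAdmissibleCover O Q) (hφ : IsBAPU Q φ) (hψ : IsBAPU Q ψ)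
    {F : I → RR d → ℝ≥0∞} {f : FourierDist O} (hf : IsLocDominated φ F f) {a : RR d → ℂ}
    (ha : Integrable a) (hs : ContDiff ℝ ∞ (𝓕 a)) (i : I) :
    ‖pairingTerm ψ f a hs i‖ₑ ≤
      ∑ l ∈ hQ.clusterFinset i, ∫⁻ x, F l x * ‖bandpass (ψ i) a x‖ₑ := by
  refine (enorm_hat_le hf (hQ.clusterFinset i) _ (sum_eq_one_of_conjTest_mul hQ hφ hψ i _
    fun ξ h => ?_)).trans_eq ?_
  · rw [mulSmooth_apply, h, zero_mul]
  · simp_rw [fourier_conjTest_mulSmooth (ψ i) ha hs, enorm_conj]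

namespace GSISystem

variable (G : GSISystem d J) {w : I → ℝ} {v : J → ℝ}

/-- The majorant of the frame coefficients of a dominated distribution. -/
noncomputable def coeffMajorant (hQ : IsAdmissibleCover O Q) (φ : I → 𝓓(O, ℂ))
    (F : I → RR d → ℝ≥0∞) (j : J) (k : Fin d → ℤ) : ℝ≥0∞ :=
  ∑' i, ∑ l ∈ hQ.clusterFinset i, ∫⁻ x, F l x * ‖bandpass (φ i) (G.atom j k) x‖ₑ

theorem schurNorm_flip {I J : Type*} (M : I → J → ℝ≥0∞) :
    schurNorm (fun j i => M i j) = schurNorm M := max_comm _ _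

/-- Minkowski over i, then the lattice correlation bound for each i, leave the transpose of M acting
on the weighted cluster sums of the ‖F_l‖_{L^p}. Schur's test gives one factor and the clustering
norm the other. -/
theorem enormCoeff_coeffMajorant_le [Countable I] [Countable J] (hQ : IsAdmissibleCover O Q)
    (hG : G.IsAdapted φ w v) (hw : ∀ i, 0 < w i) (hv : ∀ j, 0 < v j) (p q : ℝ≥0∞) (hp : 1 ≤ p)
    (hq : 1 ≤ q) (F : I → RR d → ℝ≥0∞) (hF : ∀ i, AEMeasurable (F i))
    (hFn : wlqNorm q w (fun i => eLpNorm (F i) p volume) < ⊤) :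
    G.enormCoeff v p q (G.coeffMajorant hQ φ F) ≤ schurNorm (G.schurMatrix φ w v) *
      clusterNorm Q w q * wlqNorm q w (fun i => eLpNorm (F i) p volume) := by
  have h1 : ∀ j, lqNorm p (G.coeffMajorant hQ φ F j) ≤ ∑' i,
      ENNReal.ofReal (|(G.C j).1.det| ^ (1 - (p⁻¹).toReal)) * G.amalgam φ i j *
        ∑ l ∈ hQ.clusterFinset i, eLpNorm (F l) p volume := by
    intro j
    refine (lqNorm_tsum_le (fun i k => ∑ l ∈ hQ.clusterFinset i,
      ∫⁻ x, F l x * ‖bandpass (φ i) (G.atom j k) x‖ₑ) p hp).trans (ENNReal.tsum_le_tsum fun i => ?_)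
    have h2 : ∀ k, ∑ l ∈ hQ.clusterFinset i, ∫⁻ x, F l x * ‖bandpass (φ i) (G.atom j k) x‖ₑ =
        ∫⁻ x, (∑ l ∈ hQ.clusterFinset i, F l x) * ‖bandpass (φ i) (G.g j)
          (x - Matrix.toEuclideanLin (G.C j).1 (intPoint k))‖ₑ := by
      intro k
      simp_rw [Finset.sum_mul, ← bandpass_atom]
      exact (lintegral_finsetSum' _ fun l _ =>
        (hF l).mul (G.measurable_bandpass_atom (φ i) j k).enorm.aemeasurable).symm
    simp_rw [h2]
    refine (lqNorm_lintegral_lattice_le (G.C j) _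
      (continuous_bandpass (φ i) (G.integrable_g j)).aestronglyMeasurable
      (G.amalgam_ne_top hG hw hv i j) _ (Finset.aemeasurable_fun_sum _ fun l _ => hF l) p hp).trans ?_
    refine mul_le_mul_right ?_ _
    have := eLpNorm_sum_le (s := hQ.clusterFinset i) (f := F) (μ := volume)
      (fun l _ => (hF l).aestronglyMeasurable) hp
    rwa [show (∑ l ∈ hQ.clusterFinset i, F l) = fun x => ∑ l ∈ hQ.clusterFinset i, F l x from by
      ext; simp] at this
  have h3 : ∀ j, ENNReal.ofReal (v j * |(G.C j).1.det| ^ ((p⁻¹).toReal - 1 / 2)) *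
      lqNorm p (G.coeffMajorant hQ φ F j) ≤ ∑' i, G.schurMatrix φ w v i j *
        (ENNReal.ofReal (w i) * ∑ l ∈ hQ.clusterFinset i, eLpNorm (F l) p volume) := by
    intro j
    refine (mul_le_mul_right (h1 j) _).trans ?_
    rw [← ENNReal.tsum_mul_left]
    refine ENNReal.tsum_le_tsum fun i => ?_
    exact (mul_assoc _ _ _).symm.trans_le ((mul_le_mul_left
      (G.coeffWeight_mul_amalgam_le hw hv i j _) _).trans_eq (mul_assoc _ _ _))
  have hG' : schurNorm (fun j i => G.schurMatrix φ w v i j) < ⊤ := by rwa [schurNorm_flip]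
  refine (lqNorm_mono q h3).trans ((lqNorm_matrix_le _ hG' _ q hq).trans ?_)
  rw [schurNorm_flip, mul_assoc]
  exact mul_le_mul_right (wlqNorm_sum_cluster_le hQ hw q hq _ hFn) _

theorem lt_top_of_enormCoeff_lt_top (hv : ∀ j, 0 < v j) (p q : ℝ≥0∞) (hp : 1 ≤ p)
    (hq : 1 ≤ q) {a : J → (Fin d → ℤ) → ℝ≥0∞} (ha : G.enormCoeff v p q a < ⊤) (j : J)
    (k : Fin d → ℤ) : a j k < ⊤ := by
  have h1 := (le_lqNorm q hq (fun j => ENNReal.ofReal (v j * |(G.C j).1.det| ^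
    ((p⁻¹).toReal - 1 / 2)) * lqNorm p (a j)) j).trans_lt ha
  refine (le_lqNorm p hp (a j) k).trans_lt (ENNReal.lt_top_of_mul_ne_top_right h1.ne ?_)
  have := abs_det_pos (G.C j)
  have := hv j
  simp only [ne_eq, ENNReal.ofReal_eq_zero, not_le]
  positivity

theorem tsum_enorm_pairingTerm_le (hQ : IsAdmissibleCover O Q) (hφ : IsBAPU Q φ)
    {F : I → RR d → ℝ≥0∞} {f : FourierDist O} (hf : IsLocDominated φ F f) (j : J)
    (k : Fin d → ℤ) : ∑' i, ‖pairingTerm φ f (G.atom j k) (G.contDiff_atom j k) i‖ₑ ≤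
      G.coeffMajorant hQ φ F j k :=
  ENNReal.tsum_le_tsum fun i =>
    enorm_pairingTerm_le hQ hφ hφ hf (G.integrable_atom j k) (G.contDiff_atom j k) i

theorem enorm_extPairing_le (hQ : IsAdmissibleCover O Q) (hφ : IsBAPU Q φ)
    {F : I → RR d → ℝ≥0∞} {f : FourierDist O} (hf : IsLocDominated φ F f) (j : J)
    (k : Fin d → ℤ) : ‖extPairing φ f (G.atom j k) (G.contDiff_atom j k)‖ₑ ≤
      G.coeffMajorant hQ φ F j k :=
  enorm_tsum_le_tsum_enorm.trans (G.tsum_enorm_pairingTerm_le hQ hφ hf j k)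

theorem pairingConverges [Countable I] [Countable J] (hQ : IsAdmissibleCover O Q)
    (hφ : IsBAPU Q φ) (hG : G.IsAdapted φ w v) (hw : ∀ i, 0 < w i) (hv : ∀ j, 0 < v j)
    (p q : ℝ≥0∞) (hp : 1 ≤ p) (hq : 1 ≤ q) (F : I → RR d → ℝ≥0∞) (hF : ∀ i, AEMeasurable (F i))
    (hFn : wlqNorm q w (fun i => eLpNorm (F i) p volume) < ⊤) (hQw : clusterNorm Q w q < ⊤)
    (f : FourierDist O) (hf : IsLocDominated φ F f) (j : J) (k : Fin d → ℤ) :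
    PairingConverges φ f (G.atom j k) (G.contDiff_atom j k) := by
  refine summable_norm_iff.2 (Summable.of_enorm ?_)
  refine ((G.tsum_enorm_pairingTerm_le hQ hφ hf j k).trans_lt
    (G.lt_top_of_enormCoeff_lt_top hv p q hp hq ?_ j k)).ne
  exact (G.enormCoeff_coeffMajorant_le hQ hG hw hv p q hp hq F hF hFn).trans_lt
    (ENNReal.mul_lt_top (ENNReal.mul_lt_top hG hQw) hFn)

/-- The bounded coefficient operator. -/
theorem exists_analysis [Countable J] (hQ : IsAdmissibleCover O Q)
    (hφ : IsBAPU Q φ) (hG : G.IsAdapted φ w v) (hw : ∀ i, 0 < w i) (hv : ∀ j, 0 < v j)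
    (p q : ℝ≥0∞) [hp : Fact (1 ≤ p)] [hq : Fact (1 ≤ q)] (hQw : clusterNorm Q w q < ⊤) :
    ∃ A : DecompSpace φ w p q →ₗ[ℂ] G.CoeffSpace v p q, ∀ f : DecompSpace φ w p q,
      (∀ j k, PairingConverges φ f (G.atom j k) (G.contDiff_atom j k) ∧
        (A f).1 j k = extPairing φ f (G.atom j k) (G.contDiff_atom j k)) ∧
      G.coeffNorm v p q (A f) ≤
        schurNorm (G.schurMatrix φ w v) * clusterNorm Q w q * decompNorm φ w p q f := by
  have : Countable I := hφ.countable hQ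
  have hconv : ∀ (f : DecompSpace φ w p q) j k,
      PairingConverges φ f (G.atom j k) (G.contDiff_atom j k) := by
    intro f j k
    obtain ⟨F, hF, hfF, hFn⟩ := exists_isLocDominated hw p q hq.out f.1 f.2
    exact G.pairingConverges hQ hφ hG hw hv p q hp.out hq.out F hF (hFn ▸ f.2) hQw f hfF j k
  have hnorm : ∀ f : DecompSpace φ w p q,
      G.coeffNorm v p q (fun j k => extPairing φ f (G.atom j k) (G.contDiff_atom j k)) ≤
        schurNorm (G.schurMatrix φ w v) * clusterNorm Q w q * decompNorm φ w p q f := by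
    intro f
    obtain ⟨F, hF, hfF, hFn⟩ := exists_isLocDominated hw p q hq.out f.1 f.2
    rw [← hFn]
    refine le_trans ?_ (G.enormCoeff_coeffMajorant_le hQ hG hw hv p q hp.out hq.out F hF
      (hFn ▸ f.2))
    exact wlqNorm_mono q _ fun j => lqNorm_mono p fun k => G.enorm_extPairing_le hQ hφ hfF j k
  let A₀ : DecompSpace φ w p q → G.CoeffSpace v p q := fun f =>
    ⟨fun j k => extPairing φ f (G.atom j k) (G.contDiff_atom j k),
      (hnorm f).trans_lt (ENNReal.mul_lt_top (ENNReal.mul_lt_top hG hQw) f.2)⟩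
  refine ⟨{ toFun := A₀, map_add' := ?_, map_smul' := ?_ }, fun f => ⟨fun j k => ⟨hconv f j k, rfl⟩, hnorm f⟩⟩
  · intro f g
    refine Subtype.ext (funext fun j => funext fun k => ?_)
    exact (Summable.of_norm (hconv f j k)).tsum_add (Summable.of_norm (hconv g j k))
  · intro r f
    refine Subtype.ext (funext fun j => funext fun k => ?_)
    exact tsum_mul_left

end GSISystem

end GSIFrame

/-! ### Independence of the extended pairing of the partition of unity -/

namespace GSIFrame

variable {d : ℕ} {I J : Type*} {O : Opens (RR d)} {Q : I → Set (RR d)} {φ ψ : I → 𝓓(O, ℂ)}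

/-- As in Young's inequality, Tonelli pulls the L^1 kernel 𝓕⁻¹χ out and leaves translates of b. For
members of a BAPU that L^1 factor is bounded uniformly. -/
theorem lintegral_mul_bandpass_le (χ : 𝓓(O, ℂ)) {b : RR d → ℂ} (hb : Continuous b)
    {F : RR d → ℝ≥0∞} (hF : AEMeasurable F) (B : ℝ≥0∞)
    (hB : ∀ t, ∫⁻ x, F x * ‖b (x - t)‖ₑ ≤ B) :
    ∫⁻ x, F x * ‖bandpass χ b x‖ₑ ≤ eLpNorm (𝓕⁻ (χ : RR d → ℂ)) 1 volume * B := by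
  have hm : Measurable (𝓕⁻ (χ : RR d → ℂ)) := by
    rw [fourierInv_test_eq]
    exact (𝓕⁻ (toSchwartz χ) : 𝓢(RR d, ℂ)).continuous.measurable
  have hbm : Measurable fun y : RR d × RR d => b (y.1 - y.2) :=
    (hb.comp (continuous_fst.sub continuous_snd)).measurable
  have hker : Measurable fun y : RR d × RR d => ‖𝓕⁻ (χ : RR d → ℂ) y.2‖ₑ * ‖b (y.1 - y.2)‖ₑ :=
    (hm.comp measurable_snd).enorm.mul hbm.enorm
  calc ∫⁻ x, F x * ‖bandpass χ b x‖ₑ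
      ≤ ∫⁻ x, F x * ∫⁻ t, ‖𝓕⁻ (χ : RR d → ℂ) t‖ₑ * ‖b (x - t)‖ₑ := by
        refine lintegral_mono fun x => ?_
        gcongr
        refine (enorm_integral_le_lintegral_enorm _).trans_eq ?_
        simp only [ContinuousLinearMap.mul_apply', enorm_mul]
    _ = ∫⁻ x, ∫⁻ t, F x * (‖𝓕⁻ (χ : RR d → ℂ) t‖ₑ * ‖b (x - t)‖ₑ) := by
        congr 1 with x
        exact (lintegral_const_mul _ (hker.comp measurable_prodMk_left)).symm
    _ = ∫⁻ t, ∫⁻ x, F x * (‖𝓕⁻ (χ : RR d → ℂ) t‖ₑ * ‖b (x - t)‖ₑ) :=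
        lintegral_lintegral_swap ((hF.comp_quasiMeasurePreserving
          Measure.quasiMeasurePreserving_fst).mul hker.aemeasurable)
    _ ≤ ∫⁻ t, ‖𝓕⁻ (χ : RR d → ℂ) t‖ₑ * B := by
        refine lintegral_mono fun t => ?_
        simp_rw [mul_left_comm (F _)]
        rw [lintegral_const_mul' _ _ enorm_ne_top]
        gcongr
        exact hB t
    _ = _ := by rw [lintegral_mul_const _ hm.enorm, eLpNorm_one_eq_lintegral_enorm]

/-- By this symmetry a single double family computes both pairings: summed over one index it gives
the ψ-terms, over the other the φ-terms. -/
theorem conjTest_mulTest_mulSmooth_comm (χ ζ : 𝓓(O, ℂ)) (a : RR d → ℂ) (hs : ContDiff ℝ ∞ a) :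
    conjTest (mulTest χ (toSchwartz (mulSmooth ζ a hs))) =
      conjTest (mulTest ζ (toSchwartz (mulSmooth χ a hs))) := by
  ext ξ
  simp only [conjTest_apply, mulTest_apply, toSchwartz_apply, mulSmooth_apply]
  rw [mul_left_comm]

theorem conjTest_mulTest_eq_zero (hQ : IsAdmissibleCover O Q) (hφ : IsBAPU Q φ)
    (hψ : IsBAPU Q ψ) {i m : I} (h : m ∉ hQ.clusterFinset i) (a : RR d → ℂ)
    (hs : ContDiff ℝ ∞ a) : conjTest (mulTest (ψ i) (toSchwartz (mulSmooth (φ m) a hs))) = 0 := by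
  ext ξ
  rw [conjTest_apply, mulTest_apply, toSchwartz_apply, mulSmooth_apply]
  by_cases h0 : ψ i ξ = 0
  · simp [h0]
  · simp [hφ.eq_zero_of_notMem_cluster (mt hQ.mem_clusterFinset.2 h) (hψ.mem_of_ne_zero h0)]

theorem hasSum_hat_conjTest (hQ : IsAdmissibleCover O Q) (hφ : IsBAPU Q φ)
    (hψ : IsBAPU Q ψ) (f : FourierDist O) (a : RR d → ℂ) (hs : ContDiff ℝ ∞ (𝓕 a)) (i : I) :
    HasSum (fun m => FourierDist.hat f
      (conjTest (mulTest (ψ i) (toSchwartz (mulSmooth (φ m) (𝓕 a) hs)))))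
      (pairingTerm ψ f a hs i) := by
  have h : conjTest (mulSmooth (ψ i) (𝓕 a) hs) = ∑ m ∈ hQ.clusterFinset i,
      conjTest (mulTest (ψ i) (toSchwartz (mulSmooth (φ m) (𝓕 a) hs))) := by
    ext ξ
    rw [sum_test_apply]
    simp only [conjTest_apply, mulTest_apply, toSchwartz_apply, mulSmooth_apply]
    rw [← map_sum, ← Finset.mul_sum, ← Finset.sum_mul]
    by_cases h0 : ψ i ξ = 0
    · simp [h0]
    · rw [hφ.sum_cluster_eq_one hQ (hψ.mem_of_ne_zero h0), one_mul]
  rw [pairingTerm, h, map_sum]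
  refine hasSum_sum_of_ne_finset_zero fun m hm => ?_
  rw [conjTest_mulTest_eq_zero hQ hφ hψ hm, map_zero]

namespace GSISystem

variable (G : GSISystem d J) {w : I → ℝ} {v : J → ℝ}

/-- This is the term k = 0 of the lattice correlation bound for a translate of F. Translation
preserves ‖F‖_{L^p}, so the bound is uniform in t and k. -/
theorem lintegral_mul_bandpass_atom_le (hG : G.IsAdapted φ w v) (hw : ∀ i, 0 < w i)
    (hv : ∀ j, 0 < v j) (p : ℝ≥0∞) (hp : 1 ≤ p) {F : RR d → ℝ≥0∞} (hF : AEMeasurable F) (m : I)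
    (j : J) (k : Fin d → ℤ) (t : RR d) :
    ∫⁻ x, F x * ‖bandpass (φ m) (G.atom j k) (x - t)‖ₑ ≤
      ENNReal.ofReal (|(G.C j).1.det| ^ (1 - (p⁻¹).toReal)) * G.amalgam φ m j *
        eLpNorm F p volume := by
  have hmp := measurePreserving_add_right (volume : Measure (RR d))
    (t + Matrix.toEuclideanLin (G.C j).1 (intPoint k))
  have hF' := hF.comp_quasiMeasurePreserving hmp.quasiMeasurePreserving
  have h1 := (le_lqNorm p hp _ 0).trans (lqNorm_lintegral_lattice_le (G.C j) _
    (continuous_bandpass (φ m) (G.integrable_g j)).aestronglyMeasurable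
    (G.amalgam_ne_top hG hw hv m j) _ hF' p hp)
  rw [eLpNorm_comp_measurePreserving hF.aestronglyMeasurable hmp] at h1
  refine le_trans (le_of_eq ?_) h1
  rw [← lintegral_add_right_eq_self _ (t + Matrix.toEuclideanLin (G.C j).1 (intPoint k))]
  have h0 : intPoint (0 : Fin d → ℤ) = (0 : RR d) := by
    ext a; simp [intPoint_apply]
  congr 1 with x
  rw [bandpass_atom, h0, map_zero, sub_zero, Function.comp_apply,
    show x + (t + Matrix.toEuclideanLin (G.C j).1 (intPoint k)) - t -
      Matrix.toEuclideanLin (G.C j).1 (intPoint k) = x by abel]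

/-- The double series obtained from two partitions of unity converges absolutely. -/
theorem tsum_enorm_hat_conjTest_lt_top (hQ : IsAdmissibleCover O Q) (hφ : IsBAPU Q φ)
    (hψ : IsBAPU Q ψ) (hG : G.IsAdapted φ w v) (hw : IsModerateWeight Q w)
    (hv : ∀ j, 0 < v j) (p q : ℝ≥0∞) (hp : 1 ≤ p) (hq : 1 ≤ q) (F : I → RR d → ℝ≥0∞)
    (hF : ∀ i, AEMeasurable (F i)) (hFn : wlqNorm q w (fun i => eLpNorm (F i) p volume) < ⊤)
    (f : FourierDist O) (hf : IsLocDominated φ F f) (j : J) (k : Fin d → ℤ) :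
    ∑' m, ∑' i, ‖FourierDist.hat f (conjTest (mulTest (ψ i) (toSchwartz
      (mulSmooth (φ m) (𝓕 (G.atom j k)) (G.contDiff_atom j k)))))‖ₑ < ⊤ := by
  obtain ⟨K, hK⟩ := hψ.bounded
  obtain ⟨N, hN⟩ := hQ.exists_card_le
  obtain ⟨R, hR⟩ := hw.exists_le
  set B := wlqNorm q w fun i => eLpNorm (F i) p volume
  set u := fun i m => FourierDist.hat f (conjTest (mulTest (ψ i) (toSchwartz
      (mulSmooth (φ m) (𝓕 (G.atom j k)) (G.contDiff_atom j k))))) with hu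
  set D := ENNReal.ofReal (|(G.C j).1.det| ^ (1 - (p⁻¹).toReal))
  set Θ := ENNReal.ofReal (v j * |(G.C j).1.det| ^ ((p⁻¹).toReal - 1 / 2))
  have hΘ : Θ ≠ 0 := by
    have := abs_det_pos (G.C j)
    have := hv j
    simp only [Θ, ne_eq, ENNReal.ofReal_eq_zero, not_le]
    positivity
  -- The factor 𝓕⁻¹ψ_i is replaced by its L^1 norm, at most K for every i, so the amalgam norms
  -- formed with φ control the mixed products.
  have h1 : ∀ i m, ‖u i m‖ₑ ≤
      ∑ l ∈ hQ.clusterFinset i, K * (D * G.amalgam φ m j * eLpNorm (F l) p volume) := by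
    intro i m
    refine (enorm_hat_le hf (hQ.clusterFinset i) _ (sum_eq_one_of_conjTest_mul hQ hφ hψ i _
      fun ξ h => ?_)).trans ?_
    · rw [mulTest_apply, h, zero_mul]
    · refine Finset.sum_le_sum fun l _ => ?_
      simp_rw [fourier_conjTest_mulTest, enorm_conj,
        fourierInv_mulSmooth (φ m) (G.integrable_atom j k)]
      refine (lintegral_mul_bandpass_le (ψ i)
        (continuous_bandpass (φ m) (G.integrable_atom j k)) (hF l) _ fun t =>
          G.lintegral_mul_bandpass_atom_le hG hw.pos hv p hp (hF l) m j k t).trans ?_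
      gcongr
      exact hK i
  have h2 : ∀ i m, m ∈ hQ.clusterFinset i →
      Θ * ‖u i m‖ₑ ≤ N * (K * (G.schurMatrix φ w v m j * (R * (R * B)))) := by
    intro i m hm
    calc Θ * ‖u i m‖ₑ ≤ ∑ l ∈ hQ.clusterFinset i,
          Θ * (K * (D * G.amalgam φ m j * eLpNorm (F l) p volume)) := by
          rw [← Finset.mul_sum]
          gcongr
          exact h1 i m
      _ ≤ ∑ l ∈ hQ.clusterFinset i, K * (G.schurMatrix φ w v m j * (R * (R * B))) := by
          refine Finset.sum_le_sum fun l hl => ?_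
          rw [mul_left_comm, ← mul_assoc Θ]
          refine mul_le_mul_right ((mul_le_mul_left
            (G.coeffWeight_mul_amalgam_le hw.pos hv m j _) _).trans ?_) _
          rw [mul_assoc]
          refine mul_le_mul_right ?_ _
          -- Moderateness is used twice along the chain of neighbours m, i, l: w_m ≤ R w_i ≤ R² w_l.
          calc ENNReal.ofReal (w m) * eLpNorm (F l) p volume
              ≤ (R * (R * ENNReal.ofReal (w l))) * eLpNorm (F l) p volume := by
                gcongr
                refine (hR m i (mem_cluster_comm.1 (hQ.mem_clusterFinset.1 hm))).trans ?_
                gcongr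
                exact hR i l (hQ.mem_clusterFinset.1 hl)
            _ = R * (R * (ENNReal.ofReal (w l) * eLpNorm (F l) p volume)) := by ring
            _ ≤ _ := by
                gcongr
                exact le_lqNorm q hq (fun l => ENNReal.ofReal (w l) * eLpNorm (F l) p volume) l
      _ ≤ _ := by
          rw [Finset.sum_const, nsmul_eq_mul]
          gcongr
          exact hN i
  -- One factor N counts the l in `h2`, the other the i neighbouring m; what remains is a column sum
  -- of the Schur matrix.
  have h3 : Θ * ∑' m, ∑' i, ‖u i m‖ₑ ≤
      N * (N * K * (R * (R * B))) * schurNorm (G.schurMatrix φ w v) := by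
    calc Θ * ∑' m, ∑' i, ‖u i m‖ₑ = ∑' m, ∑' i, Θ * ‖u i m‖ₑ := by
          simp_rw [ENNReal.tsum_mul_left]
      _ ≤ ∑' m, N * (N * (K * (G.schurMatrix φ w v m j * (R * (R * B))))) := by
          refine ENNReal.tsum_le_tsum fun m => ?_
          rw [tsum_eq_sum (s := hQ.clusterFinset m)]
          · refine (Finset.sum_le_sum fun i hi => h2 i m (hQ.mem_clusterFinset.2
              (mem_cluster_comm.1 (hQ.mem_clusterFinset.1 hi)))).trans ?_
            rw [Finset.sum_const, nsmul_eq_mul]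
            gcongr
            exact hN m
          · intro i hi
            have him : m ∉ hQ.clusterFinset i := fun h => hi (hQ.mem_clusterFinset.2
              (mem_cluster_comm.1 (hQ.mem_clusterFinset.1 h)))
            simp only [hu]
            rw [conjTest_mulTest_eq_zero hQ hφ hψ him, map_zero, enorm_zero, mul_zero]
      _ = N * (N * K * (R * (R * B))) * ∑' m, G.schurMatrix φ w v m j := by
          rw [← ENNReal.tsum_mul_left]
          congr 1 with m
          ring
      _ ≤ _ := by
          gcongr
          exact (le_iSup (fun j => ∑' i, G.schurMatrix φ w v i j) j).trans (le_max_right _ _)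
  refine ENNReal.lt_top_of_mul_ne_top_right (h3.trans_lt (ENNReal.mul_lt_top
    (ENNReal.mul_lt_top (ENNReal.natCast_lt_top N) (ENNReal.mul_lt_top (ENNReal.mul_lt_top
      (ENNReal.natCast_lt_top N) ENNReal.coe_lt_top) (ENNReal.mul_lt_top ENNReal.coe_lt_top
        (ENNReal.mul_lt_top ENNReal.coe_lt_top hFn)))) hG)).ne hΘ

/-- The extended pairing does not depend on the partition of unity. -/
theorem extPairing_eq (hQ : IsAdmissibleCover O Q) (hφ : IsBAPU Q φ)
    (hψ : IsBAPU Q ψ) (hG : G.IsAdapted φ w v) (hw : IsModerateWeight Q w)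
    (hv : ∀ j, 0 < v j) (p q : ℝ≥0∞) (hp : 1 ≤ p) (hq : 1 ≤ q) (F : I → RR d → ℝ≥0∞)
    (hF : ∀ i, AEMeasurable (F i)) (hFn : wlqNorm q w (fun i => eLpNorm (F i) p volume) < ⊤)
    (f : FourierDist O) (hf : IsLocDominated φ F f) (j : J) (k : Fin d → ℤ) :
    PairingConverges ψ f (G.atom j k) (G.contDiff_atom j k) ∧
      extPairing ψ f (G.atom j k) (G.contDiff_atom j k) =
        extPairing φ f (G.atom j k) (G.contDiff_atom j k) := by
  have h := G.tsum_enorm_hat_conjTest_lt_top hQ hφ hψ hG hw hv p q hp hq F hF hFn f hf j k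
  set u := fun i m => FourierDist.hat f (conjTest (mulTest (ψ i) (toSchwartz
      (mulSmooth (φ m) (𝓕 (G.atom j k)) (G.contDiff_atom j k))))) with hu
  have h1 : ∀ i, HasSum (fun m => u i m)
      (pairingTerm ψ f (G.atom j k) (G.contDiff_atom j k) i) := fun i =>
    hasSum_hat_conjTest hQ hφ hψ f _ (G.contDiff_atom j k) i
  have h2 : ∀ m, HasSum (fun i => u i m)
      (pairingTerm φ f (G.atom j k) (G.contDiff_atom j k) m) := fun m => by
    simp only [hu, conjTest_mulTest_mulSmooth_comm _ (φ m)]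
    exact hasSum_hat_conjTest hQ hψ hφ f _ (G.contDiff_atom j k) m
  rw [ENNReal.tsum_comm] at h
  refine ⟨summable_norm_iff.2 (Summable.of_enorm (ne_top_of_le_ne_top h.ne
    (ENNReal.tsum_le_tsum fun i => ?_))), ?_⟩
  · rw [← (h1 i).tsum_eq]
    exact enorm_tsum_le_tsum_enorm
  · have hs : Summable (Function.uncurry u) := by
      refine Summable.of_enorm ?_
      rw [ENNReal.tsum_prod']
      exact h.ne
    unfold extPairing
    simp_rw [← (h1 _).tsum_eq, ← (h2 _).tsum_eq]
    exact hs.tsum_comm.symm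

end GSISystem

end GSIFrame

/-! ### Reproducing kernels and limits of band-limited distributions -/

namespace GSIFrame

variable {d : ℕ} {I J : Type*} {O : Opens (RR d)} {Q : I → Set (RR d)} {φ ψ : I → 𝓓(O, ℂ)}

/-- The character `ξ ↦ exp (2 π i x ξ)`. -/
noncomputable def character (x : RR d) (ξ : RR d) : ℂ := Real.fourierChar (inner ℝ ξ x)

theorem contDiff_character (x : RR d) : ContDiff ℝ ∞ (character x) := by
  unfold character
  simp_rw [Real.fourierChar_apply]
  have h1 : ContDiff ℝ ∞ fun ξ : RR d => ((2 * Real.pi * inner ℝ ξ x : ℝ) : ℂ) :=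
    Complex.ofRealCLM.contDiff.comp (contDiff_const.mul (contDiff_id.inner ℝ contDiff_const))
  exact (h1.mul contDiff_const).cexp

/-- The Schwartz function `y ↦ (𝓕⁻¹ χ) (x - y)`. -/
noncomputable def reproKernel (χ : 𝓓(O, ℂ)) (x : RR d) : 𝓢(RR d, ℂ) :=
  𝓕 (toSchwartz (mulSmooth χ (character x) (contDiff_character x)))

theorem reproKernel_apply (χ : 𝓓(O, ℂ)) (x y : RR d) :
    reproKernel χ x y = 𝓕⁻ (χ : RR d → ℂ) (x - y) := by
  rw [reproKernel, ← fourier_test_eq, Real.fourier_eq, Real.fourierInv_eq]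
  congr 1 with ξ
  rw [mulSmooth_apply, character, Circle.smul_def, Circle.smul_def, smul_eq_mul, smul_eq_mul,
    mul_left_comm, inner_sub_right, sub_eq_add_neg, AddChar.map_add_eq_mul, Circle.coe_mul]
  ring

/-- For fixed y the kernel is also an inverse transform in x, which lets the multiplication formula
act on the variable x. -/
theorem fourierInv_character_mul (χ : 𝓓(O, ℂ)) (x y : RR d) :
    (𝓕⁻ (toSchwartz (mulSmooth χ (character (-y)) (contDiff_character (-y)))) : 𝓢(RR d, ℂ)) x =
      reproKernel χ x y := by
  rw [reproKernel_apply, ← fourierInv_test_eq, Real.fourierInv_eq, Real.fourierInv_eq]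
  congr 1 with ξ
  rw [mulSmooth_apply, character, Circle.smul_def, Circle.smul_def, smul_eq_mul, smul_eq_mul,
    mul_left_comm, inner_sub_right, sub_eq_add_neg, AddChar.map_add_eq_mul, Circle.coe_mul,
    inner_neg_right]
  ring

theorem fourier_mulTest_fourierInv (χ : 𝓓(O, ℂ)) (g : 𝓢(RR d, ℂ)) (y : RR d) :
    (𝓕 (toSchwartz (mulTest χ (𝓕⁻ g))) : 𝓢(RR d, ℂ)) y = ∫ x, g x * reproKernel χ x y := by
  simp_rw [← fourierInv_character_mul]
  rw [← SchwartzMap.integral_fourierInv_mul_eq, ← fourier_test_eq, Real.fourier_eq]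
  congr 1 with ξ
  rw [mulTest_apply, toSchwartz_apply, mulSmooth_apply, character, Circle.smul_def, smul_eq_mul,
    inner_neg_right]
  ring

theorem localize_reproduce (χ ζ : 𝓓(O, ℂ)) (h : ∀ ξ, χ ξ ≠ 0 → ζ ξ = 1) (f : FourierDist O)
    (g : 𝓢(RR d, ℂ)) : localize χ f (𝓕 (toSchwartz (mulTest ζ (𝓕⁻ g)))) = localize χ f g := by
  rw [localize_apply, localize_apply, FourierPair.fourierInv_fourier_eq]
  congr 1
  ext ξ
  rw [mulTest_apply, mulTest_apply, toSchwartz_apply, mulTest_apply]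
  by_cases h0 : χ ξ = 0
  · simp [h0]
  · rw [h ξ h0, one_mul]

/-- Uniformity in x holds because y ↦ F(x - y) has the same L^p norm for every x and the Schwartz
constant ignores F. -/
theorem exists_lintegral_mul_reproKernel_le {p : ℝ≥0∞} (hp : 1 ≤ p) (ζ : 𝓓(O, ℂ))
    {F : RR d → ℝ≥0∞} (hF : AEMeasurable F) (hFp : eLpNorm F p volume < ⊤) :
    ∃ B : ℝ≥0∞, B < ⊤ ∧ ∀ x, ∫⁻ y, F y * ‖reproKernel ζ x y‖ₑ ≤ B := by
  obtain ⟨C, hC, h⟩ := exists_lintegral_mul_schwartz_le hp (𝓕⁻ (toSchwartz ζ))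
  refine ⟨C * eLpNorm F p volume, ENNReal.mul_lt_top hC hFp, fun x => ?_⟩
  have hmp := Measure.measurePreserving_sub_left (volume : Measure (RR d)) x
  have h1 := h (F ∘ fun y => x - y) (hF.comp_quasiMeasurePreserving hmp.quasiMeasurePreserving)
  rw [eLpNorm_comp_measurePreserving hF.aestronglyMeasurable hmp] at h1
  refine le_trans (le_of_eq ?_) h1
  rw [← lintegral_sub_left_eq_self _ x]
  congr 1 with y
  rw [reproKernel_apply, sub_sub_cancel, fourierInv_test_eq, Function.comp_apply]

/-- A band-limited function is reproduced by the kernel. -/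
theorem ae_eq_localize_reproKernel {p : ℝ≥0∞} (hp : 1 ≤ p) (χ ζ : 𝓓(O, ℂ))
    (hζ : ∀ ξ, χ ξ ≠ 0 → ζ ξ = 1) (f : FourierDist O) {h : RR d → ℂ} (hh : MemLp h p volume)
    (hf : ∀ g : 𝓢(RR d, ℂ), localize χ f g = ∫ x, h x * g x) :
    ∀ᵐ x, h x = localize χ f (reproKernel ζ x) := by
  obtain ⟨B, hB, hle⟩ := exists_lintegral_mul_reproKernel_le hp ζ hh.1.enorm
    (by rw [eLpNorm_enorm]; exact hh.2)
  have hk : Continuous fun z : RR d × RR d => reproKernel ζ z.1 z.2 := by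
    simp_rw [reproKernel_apply, fourierInv_test_eq]
    exact (SchwartzMap.continuous _).comp (continuous_fst.sub continuous_snd)
  have hm : AEStronglyMeasurable (fun z : RR d × RR d => h z.2 * reproKernel ζ z.1 z.2)
      (volume.prod volume) := hh.1.comp_snd.mul hk.aestronglyMeasurable
  have hb : ∀ x, ‖localize χ f (reproKernel ζ x)‖ₑ ≤ B := fun x => by
    rw [hf]
    refine (enorm_integral_le_lintegral_enorm _).trans ?_
    simpa only [enorm_mul] using hle x
  -- Both sides are locally integrable, so comparing integrals against smooth compactly supported
  -- functions suffices.
  refine ae_eq_of_integral_contDiff_smul_eq (hh.locallyIntegrable hp) ?_ fun g hg hgc => ?_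
  · refine MemLp.locallyIntegrable (p := ⊤) ?_ le_top
    refine memLp_top_of_bound ?_ B.toReal (Eventually.of_forall fun x => ?_)
    · simp_rw [hf]
      exact hm.integral_prod_right'
    · rw [← toReal_enorm]
      exact ENNReal.toReal_mono hB.ne (hb x)
  · have hg₁ : HasCompactSupport (Complex.ofRealCLM ∘ g) := hgc.comp_left rfl
    have hg₂ : ContDiff ℝ ∞ (Complex.ofRealCLM ∘ g) := by fun_prop
    let g' : 𝓢(RR d, ℂ) := hg₁.toSchwartzMap hg₂
    have hg' : ∀ x, g' x = (g x : ℂ) := fun _ => rfl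
    have h1 : ∫ x, g x • h x = localize χ f g' := by
      rw [hf]
      simp_rw [hg', mul_comm (h _), Complex.real_smul]
    -- Inserting ζ turns ∫ g h into ∫ h(y) ∫ g(x) k(x, y) dx dy, with k the kernel of ζ; Fubini then
    -- isolates g.
    rw [h1, ← localize_reproduce χ ζ hζ, hf]
    simp_rw [fourier_mulTest_fourierInv, Complex.real_smul, ← hg', hf, ← integral_const_mul]
    rw [integral_integral_swap]
    · congr 1 with x
      congr 1 with y
      ring
    · have hm2 : AEStronglyMeasurable (fun z : RR d × RR d =>
          g' z.1 * (h z.2 * reproKernel ζ z.1 z.2)) (volume.prod volume) :=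
        (g'.continuous.comp continuous_fst).aestronglyMeasurable.mul hm
      have hi : Integrable (fun z : RR d × RR d =>
          g' z.1 * (h z.2 * reproKernel ζ z.1 z.2)) (volume.prod volume) := by
        refine ⟨hm2, ?_⟩
        rw [HasFiniteIntegral, lintegral_prod _ hm2.enorm]
        calc ∫⁻ x, ∫⁻ y, ‖g' x * (h y * reproKernel ζ x y)‖ₑ
            ≤ ∫⁻ x, ‖g' x‖ₑ * B := by
              refine lintegral_mono fun x => ?_
              simp_rw [enorm_mul]
              rw [lintegral_const_mul' _ _ enorm_ne_top]
              gcongr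
              exact hle x
          _ = (∫⁻ x, ‖g' x‖ₑ) * B := lintegral_mul_const' _ _ hB.ne
          _ < ⊤ := ENNReal.mul_lt_top g'.integrable.2 hB
      refine (hi.swap).congr (Eventually.of_forall fun z => ?_)
      simp only [Function.comp_apply, Prod.fst_swap, Prod.snd_swap, Function.uncurry]
      ring

/-- The limit of dominated band-limited distributions is given by a dominated function. -/
theorem temperedLpNorm_localize_le_of_tendsto {p : ℝ≥0∞} [hp : Fact (1 ≤ p)] (χ ζ : 𝓓(O, ℂ))
    (hζ : ∀ ξ, χ ξ ≠ 0 → ζ ξ = 1) (f : ℕ → FourierDist O) (f₀ : FourierDist O)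
    (hlim : Tendsto f atTop (𝓝 f₀)) (F : RR d → ℝ) (hF : MemLp F p volume) (h : ℕ → RR d → ℂ)
    (hc : ∀ n, Continuous (h n))
    (hf : ∀ n (g : 𝓢(RR d, ℂ)), localize χ (f n) g = ∫ x, h n x * g x)
    (hle : ∀ n x, ‖h n x‖ ≤ F x) :
    temperedLpNorm p (localize χ f₀) ≤ eLpNorm F p volume := by
  have hT : ∀ g, Tendsto (fun n => localize χ (f n) g) atTop (𝓝 (localize χ f₀ g)) := fun g =>
    PointwiseConvergenceCLM.tendsto_iff_forall_tendsto.1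
      (((localize χ).continuous.tendsto f₀).comp hlim) g
  have hFle : ∀ n x, ‖h n x‖ ≤ ‖F x‖ := fun n x => (hle n x).trans (le_abs_self _)
  have hh : ∀ n, MemLp (h n) p volume := fun n =>
    hF.mono (hc n).aestronglyMeasurable (Eventually.of_forall (hFle n))
  have hae : ∀ᵐ x, ∀ n, h n x = localize χ (f n) (reproKernel ζ x) :=
    ae_all_iff.2 fun n => ae_eq_localize_reproKernel hp.out χ ζ hζ (f n) (hh n) (hf n)
  -- The limit function is defined by evaluating f₀ on the kernels. Weak-star convergence on the
  -- fixed kernel at x makes it the almost everywhere limit of the h_n.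
  let h₀ : RR d → ℂ := fun x => localize χ f₀ (reproKernel ζ x)
  have hlim₀ : ∀ᵐ x, Tendsto (fun n => h n x) atTop (𝓝 (h₀ x)) := by
    filter_upwards [hae] with x hx
    simpa only [hx] using hT (reproKernel ζ x)
  have hle₀ : ∀ᵐ x, ‖h₀ x‖ ≤ ‖F x‖ := by
    filter_upwards [hlim₀] with x hx
    exact le_of_tendsto hx.norm (Eventually.of_forall fun n => hFle n x)
  have hm₀ : AEStronglyMeasurable h₀ := aestronglyMeasurable_of_tendsto_ae atTop
    (fun n => (hc n).aestronglyMeasurable) hlim₀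
  have hh₀ : MemLp h₀ p volume := hF.mono hm₀ hle₀
  refine (temperedLpNorm_le p _ hh₀ fun g => ?_).trans (eLpNorm_mono_ae hle₀)
  refine tendsto_nhds_unique (hT g) ?_
  simp_rw [hf]
  refine tendsto_integral_of_dominated_convergence (fun x => ‖F x‖ * ‖g x‖)
    (fun n => ((hc n).mul g.continuous).aestronglyMeasurable) ?_ ?_ ?_
  · refine ⟨hF.1.norm.mul g.continuous.norm.aestronglyMeasurable, ?_⟩
    have := lintegral_mul_schwartz_lt_top hF.1.enorm hp.out
      (by rw [eLpNorm_enorm]; exact hF.2) g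
    simpa only [HasFiniteIntegral, enorm_mul, enorm_norm] using this
  · refine fun n => Eventually.of_forall fun x => ?_
    rw [norm_mul]
    gcongr
    exact hFle n x
  · filter_upwards [hlim₀] with x hx using hx.mul_const _

end GSIFrame

/-! ### Dominated convergence and the frame operator -/

namespace GSIFrame

variable {d : ℕ} {I J : Type*} {O : Opens (RR d)} {Q : I → Set (RR d)} {φ : I → 𝓓(O, ℂ)}

/-- Limits of dominated sequences belong to the decomposition space. -/
theorem mem_decompSpace_of_isDominated (hQ : IsAdmissibleCover O Q) (hφ : IsBAPU Q φ) {w : I → ℝ}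
    (p q : ℝ≥0∞) [Fact (1 ≤ p)] [Fact (1 ≤ q)] (f : ℕ → FourierDist O) (f₀ : FourierDist O)
    (F : I → RR d → ℝ) (hF : MemLqLp w p q F) (hf : ∀ n, IsDominated φ F (f n))
    (hlim : Tendsto f atTop (𝓝 f₀)) : f₀ ∈ DecompSpace φ w p q := by
  refine (wlqNorm_mono q w fun i => ?_).trans_lt hF.norm_lt_top
  choose h hc hint hle using fun n => hf n i
  -- The cluster sum of the φ_l equals one on Q_i, hence wherever φ_i ≠ 0.
  refine temperedLpNorm_localize_le_of_tendsto (φ i) (∑ l ∈ hQ.clusterFinset i, φ l)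
    (fun ξ hξ => ?_) f f₀ hlim (F i) (hF.memLp i) h (fun n => (hc n).continuous) hint hle
  rw [sum_test_apply]
  exact hφ.sum_cluster_eq_one hQ (hφ.mem_of_ne_zero hξ)

theorem isLocDominated_of_isDominated {F : I → RR d → ℝ} {f : FourierDist O}
    (hf : IsDominated φ F f) : IsLocDominated φ (fun i x => ‖F i x‖ₑ) f := by
  choose h _ hint hle using hf
  refine isLocDominated_of_integral hint fun i => Eventually.of_forall fun x => ?_
  exact enorm_le_iff_norm_le.2 ((hle i x).trans (le_abs_self _))

/-- Dominated convergence for the extended pairing. -/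
theorem GSISystem.tendsto_extPairing (G : GSISystem d J) (hQ : IsAdmissibleCover O Q)
    (hφ : IsBAPU Q φ) {F : I → RR d → ℝ≥0∞} {f : ℕ → FourierDist O} {f₀ : FourierDist O}
    (hf : ∀ n, IsLocDominated φ F (f n)) (hlim : Tendsto f atTop (𝓝 f₀)) (j : J) (k : Fin d → ℤ)
    (hfin : G.coeffMajorant hQ φ F j k < ⊤) :
    Tendsto (fun n => extPairing φ (f n) (G.atom j k) (G.contDiff_atom j k)) atTop
      (𝓝 (extPairing φ f₀ (G.atom j k) (G.contDiff_atom j k))) := by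
  refine tendsto_tsum_of_dominated_convergence (ENNReal.summable_toReal hfin.ne)
    (fun i => ?_) (Eventually.of_forall fun n i => ?_)
  -- Each term evaluates the distribution at one fixed element of Z(O).
  · exact PointwiseConvergenceCLM.tendsto_iff_forall_tendsto.1 hlim _
  · rw [← toReal_enorm]
    exact ENNReal.toReal_mono (ENNReal.ne_top_of_tsum_ne_top hfin.ne i)
      (enorm_pairingTerm_le hQ hφ hφ (hf n) (G.integrable_atom j k) (G.contDiff_atom j k) i)

end GSIFrame

theorem mainTheorem7 {d : ℕ} {I J : Type*} [Countable J]
    -- the decomposition cover, its BAPU, and the weights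
    (O : Opens (RR d)) (hO : (O : Set (RR d)).Nonempty)
    (Q : I → Set (RR d)) (hQ : IsAdmissibleCover O Q)
    (Φ : I → 𝓓(O, ℂ)) (hΦ : IsBAPU Q Φ)
    (w : I → ℝ) (hw : IsModerateWeight Q w)
    (v : J → ℝ) (hv : ∀ j, 0 < v j)
    -- the adapted GSI system
    (G : GSISystem d J) (hG : G.IsAdapted Φ w v)
    (p q : ℝ≥0∞) [Fact (1 ≤ p)] [Fact (1 ≤ q)] :
    clusterNorm Q w q < ⊤ ∧
    ∃ (D : G.CoeffSpace v p q →ₗ[ℂ] DecompSpace Φ w p q)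
      (A : DecompSpace Φ w p q →ₗ[ℂ] G.CoeffSpace v p q),
      -- (i) the reconstruction operator `D`
      (∀ c : G.CoeffSpace v p q,
        HasSum (fun jk : J × (Fin d → ℤ) => c.1 jk.1 jk.2 • G.atomZ O jk.1 jk.2)
          (D c : FourierDist O)) ∧
      (∀ c : G.CoeffSpace v p q,
        decompNorm Φ w p q (D c) ≤ schurNorm (G.schurMatrix Φ w v) * G.coeffNorm v p q c) ∧
      -- (ii) the coefficient operator `A`
      (∀ (f : DecompSpace Φ w p q) (j : J) (k : Fin d → ℤ),
        PairingConverges Φ f (G.atom j k) (G.contDiff_atom j k) ∧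
        (A f).1 j k = extPairing Φ f (G.atom j k) (G.contDiff_atom j k)) ∧
      (∀ f : DecompSpace Φ w p q,
        G.coeffNorm v p q (A f) ≤
          schurNorm (G.schurMatrix Φ w v) * clusterNorm Q w q * decompNorm Φ w p q f) ∧
      -- (iii) independence of the extended pairing of the BAPU
      (∀ Ψ : I → 𝓓(O, ℂ), IsBAPU Q Ψ →
        ∀ (f : DecompSpace Φ w p q) (j : J) (k : Fin d → ℤ),
          PairingConverges Ψ f (G.atom j k) (G.contDiff_atom j k) ∧
          extPairing Ψ f (G.atom j k) (G.contDiff_atom j k) =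
            extPairing Φ f (G.atom j k) (G.contDiff_atom j k)) ∧
      -- the frame operator `S = D ∘ A`
      (∃ K : ℝ≥0, ∀ f : DecompSpace Φ w p q,
        decompNorm Φ w p q (D (A f)) ≤ K * decompNorm Φ w p q f) ∧
      (∀ (f : ℕ → DecompSpace Φ w p q) (f₀ : FourierDist O) (F : I → RR d → ℝ),
        MemLqLp w p q F →
        (∀ n, IsDominated Φ F (f n : FourierDist O)) →
        Tendsto (fun n => (f n : FourierDist O)) atTop (𝓝 f₀) →
        ∃ hf₀ : f₀ ∈ DecompSpace Φ w p q,
          Tendsto (fun n => (D (A (f n)) : FourierDist O)) atTop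
            (𝓝 (D (A ⟨f₀, hf₀⟩) : FourierDist O))) := by
  have hI : Countable I := hΦ.countable hQ
  have hp : 1 ≤ p := Fact.out
  have hq : 1 ≤ q := Fact.out
  have hΓ : clusterNorm Q w q < ⊤ := clusterNorm_lt_top hQ hΦ hw q hq
  obtain ⟨D, hD⟩ := G.exists_synthesis hQ hΦ hG hw.pos hv p q
  obtain ⟨A, hA⟩ := G.exists_analysis hQ hΦ hG hw.pos hv p q hΓ
  refine ⟨hΓ, D, A, fun c => (hD c).1, fun c => (hD c).2, fun f j k => (hA f).1 j k,
    fun f => (hA f).2, fun Ψ hΨ f j k => ?_, ?_, fun f f₀ F hF hdom hlim => ?_⟩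
  · obtain ⟨F, hF, hfF, hFn⟩ := exists_isLocDominated hw.pos p q hq f.1 f.2
    exact G.extPairing_eq hQ hΦ hΨ hG hw hv p q hp hq F hF (hFn ▸ f.2) f hfF j k
  · have hK : schurNorm (G.schurMatrix Φ w v) *
        (schurNorm (G.schurMatrix Φ w v) * clusterNorm Q w q) ≠ ⊤ :=
      (ENNReal.mul_lt_top hG (ENNReal.mul_lt_top hG hΓ)).ne
    refine ⟨(schurNorm (G.schurMatrix Φ w v) *
      (schurNorm (G.schurMatrix Φ w v) * clusterNorm Q w q)).toNNReal, fun f => ?_⟩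
    rw [ENNReal.coe_toNNReal hK, mul_assoc]
    exact (hD (A f)).2.trans (mul_le_mul_right (hA f).2 _)
  · have hf₀ := mem_decompSpace_of_isDominated hQ hΦ p q (fun n => (f n : FourierDist O)) f₀ F hF
      hdom hlim
    have hFm : ∀ i, AEMeasurable fun x => ‖F i x‖ₑ := fun i => (hF.memLp i).1.enorm
    have hFn : wlqNorm q w (fun i => eLpNorm (fun x => ‖F i x‖ₑ) p volume) < ⊤ := by
      simpa only [eLpNorm_enorm] using hF.norm_lt_top
    -- The array built from F has finite Y_v^{p,q} norm and dominates the coefficients of all f_n;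
    -- it drives both the limit of the coefficients and the limit of the synthesis.
    have ha := (G.enormCoeff_coeffMajorant_le hQ hG hw.pos hv p q hp hq _ hFm hFn).trans_lt
      (ENNReal.mul_lt_top (ENNReal.mul_lt_top hG hΓ) hFn)
    have hloc : ∀ n, IsLocDominated Φ (fun i x => ‖F i x‖ₑ) (f n : FourierDist O) := fun n =>
      isLocDominated_of_isDominated (hdom n)
    refine ⟨hf₀, G.tendsto_synthesis hQ hΦ hG hw.pos hv p q hp hq _ ha
      (fun n => (A (f n)).1) (A ⟨f₀, hf₀⟩).1 (fun n j k => ?_) (fun j k => ?_) _ _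
      (fun n => (hD (A (f n))).1) (hD (A ⟨f₀, hf₀⟩)).1⟩
    · rw [((hA (f n)).1 j k).2]
      exact G.enorm_extPairing_le hQ hΦ (hloc n) j k
    · simp_rw [fun g => ((hA g).1 j k).2]
      exact G.tendsto_extPairing hQ hΦ hloc hlim j k
        (G.lt_top_of_enormCoeff_lt_top hv p q hp hq ha j k)
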